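/- Let $\alpha,\beta,\gamma>0$ with $\alpha<\beta$. Write $W^{1,\infty}_{\mathrm{sym}}(\Omega)$ for the symmetric $3\times3$ real matrix-valued functions on $\Omega$ with entries in $W^{1,\infty}(\Omega)$, and $$\mathcal E=\{\varepsilon\in W^{1,\infty}_{\mathrm{sym}}(\Omega): \exists\, c>0,\ \varepsilon(x)\xi\cdot\xi\ge c|\xi|^2 \text{ for a.e. } x\in\Omega \text{ and all } \xi\in\mathbb R^3\},$$ $$\mathcal A_{\alpha,\beta,\gamma}=\{\varepsilon\in W^{1,\infty}_{\mathrm{sym}}(\Omega): \alpha|\xi|^2\le\varepsilon(x)\xi\cdot\xi\le\beta|\xi|^2 \text{ for a.e. } x\in\Omega \text{ and all }\xi\in\mathbb R^3,\ \|\partial_k\varepsilon_{ij}\|_{L^\infty(\Omega)}\le\gamma\ \forall i,j,k\}.$$ Let $\langle u,v\rangle_\varepsilon=\int_\Omega \varepsilon u\cdot v\,dx$ with norm $\|u\|_{L^2_\varepsilon(\Omega)}=\langle u,u\rangle_\varepsilon^{1/2}$ on $L^2(\Omega)^3$, let $H_0(\operatorname{curl},\Omega)$ be the closure of $C_c^\infty(\Omega)^3$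 in $H(\operatorname{curl},\Omega)$, and let $$X^\varepsilon_{N}(\Omega)=H_0(\operatorname{curl},\Omega)\cap\{u\in L^2(\Omega)^3:\operatorname{div}(\varepsilon u)\in L^2(\Omega)\},$$ $$\|u\|_{X^\varepsilon_N(\Omega)}^2=\|u\|_{L^2_\varepsilon(\Omega)}^2+\|\operatorname{curl}u\|_{L^2(\Omega)^3}^2+\|\operatorname{div}(\varepsilon u)\|_{L^2(\Omega)}^2 .$$ Let $\Omega\subset\mathbb R^3$ be a bounded Lipschitz domain on which the Gaffney inequality holds uniformly on $\mathcal A_{\alpha,\beta,\gamma}$: there is $C>0$ such that, for every $\varepsilon\in\mathcal A_{\alpha,\beta,\gamma}$, every $u\in X_N^\varepsilon(\Omega)$ belongs to $H^1(\Omega)^3$ and $\|u\|_{H^1(\Omega)^3}\le C\|u\|_{X_N^\varepsilon(\Omega)}$. Let $\varepsilon\in\mathcal E$ and $\tau>0$. Consider the eigenvalue problem for $\sigma\in\mathbb R$ and $0\ne u\in X_N^\varepsilon(\Omega)$ $$\int_\Omega\operatorname{curl}u\cdot\operatorname{curl}v\,dx+\tau\int_\Omega\operatorname{div}(\varepsilon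 u)\operatorname{div}(\varepsilon v)\,dx=\sigma\int_\Omega\varepsilon u\cdot v\,dx\qquad\forall v\in X_N^\varepsilon(\Omega),\tag{1}$$ with eigenvalues $0\le\sigma_1[\varepsilon]\le\sigma_2[\varepsilon]\le\cdots$ repeated according to multiplicity, and put $$T_\varepsilon[u,v]=\int_\Omega\varepsilon u\cdot v\,dx+\int_\Omega\operatorname{curl}u\cdot\operatorname{curl}v\,dx+\tau\int_\Omega\operatorname{div}(\varepsilon u)\operatorname{div}(\varepsilon v)\,dx .$$ Let $M\ge0$ be an integer, let $u_1,\dots,u_M$ be $\langle\cdot,\cdot\rangle_\varepsilon$-orthonormal eigenfunctions of (1) corresponding to $\sigma_1[\varepsilon],\dots,\sigma_M[\varepsilon]$, let $P_Mu=\sum_{i=1}^M\langle u,u_i\rangle_\varepsilon u_i$, and define $$f_{M+1}(u)=\tfrac12T_\varepsilon[u,u]-\|(I-P_M)u\|_{L^2_\varepsilon(\Omega)},\qquad u\in X_N^\varepsilon(\Omega).$$ **Theorem (Auchmuty Principle).** The functional $f_{M+1}$ attains its minimum on $X_N^\varepsilon(\Omega)$, and $$\min_{X_N^\varepsilon(\Omega)}f_{M+1}=-\tfrac12\,(\sigma_{M+1}[\varepsilon]+1)^{-1}.$$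 There is an eigenfunction $\hat u_{M+1}$ of (1) with eigenvalue $\sigma_{M+1}[\varepsilon]$, orthogonal to $u_1,\dots,u_M$ with respect to $\langle\cdot,\cdot\rangle_\varepsilon$, such that $\|\hat u_{M+1}\|_{L^2_\varepsilon(\Omega)}=(\sigma_{M+1}[\varepsilon]+1)^{-1}$; and for every such $\hat u_{M+1}$ the minimum is attained at both $\hat u_{M+1}$ and $-\hat u_{M+1}$. -/

import Mathlib

open MeasureTheory TopologicalSpace Filter Topology
open scoped Distributions ENNReal NNReal

noncomputable section

namespace Cavity

/-- Three-dimensional Euclidean space. -/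
abbrev E3 : Type := EuclideanSpace ℝ (Fin 3)

/-- `Ω` is a bounded Lipschitz domain: bounded, (open and) connected, nonempty, and near each
boundary point it is, in suitable Cartesian coordinates, the set of points strictly above the graph
of a Lipschitz function. -/
structure IsBoundedLipschitzDomain (Ω : Opens E3) : Prop where
  isBounded : Bornology.IsBounded (Ω : Set E3)
  isConnected : IsConnected (Ω : Set E3)
  locally_graph : ∀ p ∈ frontier (Ω : Set E3),
    ∃ (r : ℝ) (b : OrthonormalBasis (Fin 3) ℝ E3) (K : ℝ≥0) (h : ℝ × ℝ → ℝ),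
      0 < r ∧ LipschitzWith K h ∧
      ∀ x ∈ Metric.ball p r,
        (x ∈ Ω ↔ h (inner ℝ (b 0) x, inner ℝ (b 1) x) < inner ℝ (b 2) x)

/-- Lebesgue measure on `Ω`. -/
abbrev vol (Ω : Opens E3) : Measure E3 := volume.restrict (Ω : Set E3)

/-- The space `L²(Ω)³` of square integrable vector fields. -/
abbrev VecL2 (Ω : Opens E3) : Type := Lp E3 2 (vol Ω)

/-- The space `L²(Ω)` of square integrable functions. -/
abbrev ScalL2 (Ω : Opens E3) : Type := Lp ℝ 2 (vol Ω)

/-- The classical partial derivative in the direction of the `k`-th coordinate vector. -/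
def partialDeriv {F : Type} [NormedAddCommGroup F] [NormedSpace ℝ F]
    (k : Fin 3) (φ : E3 → F) (x : E3) : F :=
  fderiv ℝ φ x (EuclideanSpace.single k (1 : ℝ))

/-- The classical curl of a vector field. -/
def classicalCurl (φ : E3 → E3) (x : E3) : E3 :=
  !₂[partialDeriv 1 φ x 2 - partialDeriv 2 φ x 1,
     partialDeriv 2 φ x 0 - partialDeriv 0 φ x 2,
     partialDeriv 0 φ x 1 - partialDeriv 1 φ x 0]

/-- `g` is the weak partial derivative `∂ₖ f` in `Ω`. -/
def HasWeakPartial (Ω : Opens E3) (k : Fin 3) (f g : E3 → ℝ) : Prop :=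
  ∀ φ : 𝓓(Ω, ℝ), ∫ x in (Ω : Set E3), f x * partialDeriv k φ x
    = - ∫ x in (Ω : Set E3), g x * φ x

/-! ### Permittivities -/

/-- `ε` is a matrix-valued function of class `W^{1,∞}(Ω)^{3×3}`, symmetric almost everywhere. -/
structure IsW1inftySym (Ω : Opens E3) (ε : E3 → Matrix (Fin 3) (Fin 3) ℝ) : Prop where
  memLp : ∀ i j, MemLp (fun x => ε x i j) ∞ (vol Ω)
  exists_weakPartial : ∀ i j k, ∃ g : E3 → ℝ,
    MemLp g ∞ (vol Ω) ∧ HasWeakPartial Ω k (fun x => ε x i j) g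
  symm : ∀ᵐ x ∂(vol Ω), (ε x).IsSymm

/-- `M ξ · η`. -/
def mdot (M : Matrix (Fin 3) (Fin 3) ℝ) (ξ η : E3) : ℝ :=
  M.mulVec ξ.ofLp ⬝ᵥ η.ofLp

/-- The class `𝓔` of admissible permittivities. -/
def Admissible (Ω : Opens E3) (ε : E3 → Matrix (Fin 3) (Fin 3) ℝ) : Prop :=
  IsW1inftySym Ω ε ∧
    ∃ c : ℝ, 0 < c ∧ ∀ᵐ x ∂(vol Ω), ∀ ξ : E3, c * ‖ξ‖ ^ 2 ≤ mdot (ε x) ξ ξ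

/-- The class `𝓐_{α,β,γ}` of permittivities with prescribed bounds. -/
def AdmissibleBdd (Ω : Opens E3) (α β γ : ℝ) (ε : E3 → Matrix (Fin 3) (Fin 3) ℝ) : Prop :=
  IsW1inftySym Ω ε ∧
    (∀ᵐ x ∂(vol Ω), ∀ ξ : E3,
      α * ‖ξ‖ ^ 2 ≤ mdot (ε x) ξ ξ ∧ mdot (ε x) ξ ξ ≤ β * ‖ξ‖ ^ 2) ∧
    ∀ i j k, ∃ g : E3 → ℝ, AEStronglyMeasurable g (vol Ω) ∧
      HasWeakPartial Ω k (fun x => ε x i j) g ∧ ∀ᵐ x ∂(vol Ω), |g x| ≤ γ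

/-! ### Function spaces -/

/-- `w ∈ L²(Ω)³` is the weak curl of `u`. -/
def HasWeakCurl (Ω : Opens E3) (u w : VecL2 Ω) : Prop :=
  ∀ φ : 𝓓(Ω, E3), ∫ x in (Ω : Set E3), inner ℝ (u x) (classicalCurl φ x)
    = ∫ x in (Ω : Set E3), inner ℝ (w x) (φ x)

/-- `d ∈ L²(Ω)` is the weak divergence of `ε u`. -/
def HasWeakDiv (Ω : Opens E3) (ε : E3 → Matrix (Fin 3) (Fin 3) ℝ)
    (u : VecL2 Ω) (d : ScalL2 Ω) : Prop :=
  ∀ φ : 𝓓(Ω, ℝ), ∫ x in (Ω : Set E3), mdot (ε x) (u x) (gradient φ x)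
    = - ∫ x in (Ω : Set E3), d x * φ x

open Classical in
/-- The weak curl of `u` (zero if there is none in `L²(Ω)³`). -/
def curl (Ω : Opens E3) (u : VecL2 Ω) : VecL2 Ω :=
  if h : ∃ w, HasWeakCurl Ω u w then h.choose else 0

open Classical in
/-- The weak divergence `div (ε u)` (zero if there is none in `L²(Ω)`). -/
def divEps (Ω : Opens E3) (ε : E3 → Matrix (Fin 3) (Fin 3) ℝ) (u : VecL2 Ω) : ScalL2 Ω :=
  if h : ∃ d, HasWeakDiv Ω ε u d then h.choose else 0

/-- `H(curl, Ω)`. -/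
def HCurl (Ω : Opens E3) : Set (VecL2 Ω) :=
  {u | ∃ w, HasWeakCurl Ω u w}

/-- `H₀(curl, Ω)`: the closure of the smooth compactly supported vector fields in the norm of
`H(curl, Ω)`. -/
def HCurlZero (Ω : Opens E3) : Set (VecL2 Ω) :=
  {u | u ∈ HCurl Ω ∧ ∃ φ : ℕ → 𝓓(Ω, E3),
    Tendsto (fun n => eLpNorm (fun x => u x - φ n x) 2 (vol Ω)) atTop (𝓝 0) ∧
    Tendsto (fun n => eLpNorm (fun x => curl Ω u x - classicalCurl (φ n) x) 2 (vol Ω))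
      atTop (𝓝 0)}

/-- `H(div ε, Ω)`. -/
def HDiv (Ω : Opens E3) (ε : E3 → Matrix (Fin 3) (Fin 3) ℝ) : Set (VecL2 Ω) :=
  {u | ∃ d, HasWeakDiv Ω ε u d}

/-- `X_N^ε(Ω) = H₀(curl, Ω) ∩ H(div ε, Ω)`. -/
def XN (Ω : Opens E3) (ε : E3 → Matrix (Fin 3) (Fin 3) ℝ) : Set (VecL2 Ω) :=
  HCurlZero Ω ∩ HDiv Ω ε

/-- The inner product `⟨u, v⟩_ε = ∫_Ω ε u · v`. -/
def innerEps (Ω : Opens E3) (ε : E3 → Matrix (Fin 3) (Fin 3) ℝ) (u v : VecL2 Ω) : ℝ :=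
  ∫ x in (Ω : Set E3), mdot (ε x) (u x) (v x)

/-- The norm of `L²_ε(Ω)`. -/
def normEps (Ω : Opens E3) (ε : E3 → Matrix (Fin 3) (Fin 3) ℝ) (u : VecL2 Ω) : ℝ :=
  Real.sqrt (innerEps Ω ε u u)

/-- The norm of `X_N^ε(Ω)`. -/
def normXN (Ω : Opens E3) (ε : E3 → Matrix (Fin 3) (Fin 3) ℝ) (u : VecL2 Ω) : ℝ :=
  Real.sqrt (innerEps Ω ε u u + ‖curl Ω u‖ ^ 2 + ‖divEps Ω ε u‖ ^ 2)

/-- The Gaffney inequality with constant `C`: every `u ∈ X_N^ε(Ω)` is in `H¹(Ω)³` (`D i k` being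
the weak derivative `∂ₖ uᵢ`), and `‖u‖_{H¹(Ω)³} ≤ C ‖u‖_{X_N^ε(Ω)}`. -/
def Gaffney (Ω : Opens E3) (ε : E3 → Matrix (Fin 3) (Fin 3) ℝ) (C : ℝ) : Prop :=
  ∀ u ∈ XN Ω ε, ∃ D : Fin 3 → Fin 3 → ScalL2 Ω,
    (∀ i k, HasWeakPartial Ω k (fun x => u x i) (D i k)) ∧
    Real.sqrt (‖u‖ ^ 2 + ∑ i, ∑ k, ‖D i k‖ ^ 2) ≤ C * normXN Ω ε u

/-- The standing assumption on `Ω` relative to `α, β, γ`: it is a bounded Lipschitz domain on which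
the Gaffney inequality holds with a constant independent of `ε ∈ 𝓐_{α,β,γ}`. -/
def IsGaffneyDomain (Ω : Opens E3) (α β γ : ℝ) : Prop :=
  IsBoundedLipschitzDomain Ω ∧
    ∃ C : ℝ, 0 < C ∧ ∀ ε, AdmissibleBdd Ω α β γ ε → Gaffney Ω ε C

/-! ### The penalized eigenvalue problem -/

/-- `T_ε[u, v] = ∫ ε u · v + ∫ curl u · curl v + τ ∫ div (ε u) div (ε v)`. -/
def Tform (Ω : Opens E3) (ε : E3 → Matrix (Fin 3) (Fin 3) ℝ) (τ : ℝ) (u v : VecL2 Ω) : ℝ :=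
  innerEps Ω ε u v + (∫ x in (Ω : Set E3), inner ℝ (curl Ω u x) (curl Ω v x))
    + τ * ∫ x in (Ω : Set E3), divEps Ω ε u x * divEps Ω ε v x

/-- `u` is an eigenfunction of the penalized problem with eigenvalue `s`: `u ∈ X_N^ε(Ω)`, `u ≠ 0`
and `∫ curl u · curl v + τ ∫ div (ε u) div (ε v) = s ∫ ε u · v` for all `v ∈ X_N^ε(Ω)`. -/
def IsEigenfunction (Ω : Opens E3) (ε : E3 → Matrix (Fin 3) (Fin 3) ℝ) (τ s : ℝ)
    (u : VecL2 Ω) : Prop :=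
  u ∈ XN Ω ε ∧ u ≠ 0 ∧ ∀ v ∈ XN Ω ε,
    (∫ x in (Ω : Set E3), inner ℝ (curl Ω u x) (curl Ω v x))
      + τ * (∫ x in (Ω : Set E3), divEps Ω ε u x * divEps Ω ε v x)
      = s * innerEps Ω ε u v

/-- The `j`-th eigenvalue `σ_j[ε]`, `j ≥ 1`, of the penalized problem, in non-decreasing order and
repeated according to multiplicity: the least `s` such that the eigenvalues not exceeding `s` have
total multiplicity at least `j`. -/
def sigma (Ω : Opens E3) (ε : E3 → Matrix (Fin 3) (Fin 3) ℝ) (τ : ℝ) (j : ℕ) : ℝ :=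
  sInf {s : ℝ | (j : Cardinal) ≤
    Module.rank ℝ (Submodule.span ℝ {u : VecL2 Ω | ∃ t ≤ s, IsEigenfunction Ω ε τ t u})}

/-- The projection `P_M u = ∑ᵢ ⟨u, uᵢ⟩_ε uᵢ`. -/
def proj (Ω : Opens E3) (ε : E3 → Matrix (Fin 3) (Fin 3) ℝ) {M : ℕ} (e : Fin M → VecL2 Ω)
    (u : VecL2 Ω) : VecL2 Ω :=
  ∑ i, innerEps Ω ε u (e i) • e i

/-- The functional `f_{M+1}(u) = ½ T_ε[u, u] - ‖(I - P_M) u‖_{L²_ε(Ω)}`. -/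
def auchmuty (Ω : Opens E3) (ε : E3 → Matrix (Fin 3) (Fin 3) ℝ) (τ : ℝ) {M : ℕ}
    (e : Fin M → VecL2 Ω) (u : VecL2 Ω) : ℝ :=
  1 / 2 * Tform Ω ε τ u u - normEps Ω ε (u - proj Ω ε e u)

end Cavity

end

/-!
The proof has three ingredients.

*Compactness.* A sequence bounded in `X_N^ε(Ω)` has a subsequence converging strongly in `L²(Ω)³`
(`exists_subseq_XN`). The permittivity `ε` need not satisfy the bounds for which the Gaffney
inequality is assumed, so it is only applied to the constant permittivity `α I`. A weakly null
sequence `v n` is split as `P (v n) + w n`, where `P` is the `L²`-orthogonal projection onto the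
closure of the gradients of test functions. The fields `w n` are divergence free and have the same
curl as `v n`; the Gaffney inequality bounds them in `H¹` and Rellich's theorem
(`tendsto_norm_of_weakTendsto`) makes them converge strongly. The gradient part is close to `∇ψ n`
with test functions `ψ n`, which are strongly precompact in `L²` by the Poincaré inequality and
Rellich's theorem; pairing `div (ε (v n))` with `ψ n` and using the coercivity of `ε` gives
`∇ψ n → 0`.

*Rellich's theorem* is proved on a bounded Lipschitz domain without an extension operator: near
every point of the closure there are small balls `H` of vectors such that the segments
`x + [0, 1] h` with `h ∈ H` remain in `Ω`. The `L²` norm of `f` near the point exceeds that of the averages of `f`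
over `x + H` by at most a constant times `sup |h| ‖∇f‖` (`norm_restrL2_le`), which is shown by
duality with test functions, and the averages of a weakly null sequence converge strongly by
dominated convergence (`tendsto_norm_ballIntegral`).

*Spectral theory.* By compactness the Rayleigh quotient attains its minimum on the orthogonal
complement of the first `M` eigenfunctions, at an eigenfunction. That minimum equals `σ_{M+1}`
(`IsCompactPair.exists_eigenvector`): adjoining the minimizer to the previous eigenfunctions gives
`M + 1` independent ones, while an eigenfunction with a smaller eigenvalue lies in the span of the
first `M`. With `r = ‖(I - P_M) u‖_ε` the functional is therefore at least
`(σ_{M+1} + 1) r² / 2 - r`, whose minimum `-1 / (2 (σ_{M+1} + 1))` is attained at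
`r = 1 / (σ_{M+1} + 1)`.
-/

noncomputable section

namespace Cavity

/-! ### Test functions as elements of `L²` -/

section TestFunctions

variable {F : Type} [NormedAddCommGroup F] [InnerProductSpace ℝ F]

theorem memLp_testFunction (Ω : Opens E3) (p : ℝ≥0∞) (φ : 𝓓(Ω, F)) : MemLp φ p (vol Ω) :=
  (φ.continuous.memLp_of_hasCompactSupport φ.hasCompactSupport).restrict _

/-- The class in `L²(Ω)` of a test function. -/
def testL2 (Ω : Opens E3) : 𝓓(Ω, F) →ₗ[ℝ] Lp F 2 (vol Ω) where
  toFun φ := MemLp.toLp (φ : E3 → F) (memLp_testFunction Ω 2 φ)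
  map_add' φ ψ := by
    exact MemLp.toLp_add (memLp_testFunction Ω 2 φ) (memLp_testFunction Ω 2 ψ)
  map_smul' c φ := by
    exact MemLp.toLp_const_smul c (memLp_testFunction Ω 2 φ)

theorem coeFn_testL2 {Ω : Opens E3} (φ : 𝓓(Ω, F)) : testL2 Ω φ =ᵐ[vol Ω] φ :=
  MemLp.coeFn_toLp (memLp_testFunction Ω 2 φ)

theorem inner_testL2 {Ω : Opens E3} (f : Lp F 2 (vol Ω)) (φ : 𝓓(Ω, F)) :
    inner ℝ f (testL2 Ω φ) = ∫ x in (Ω : Set E3), inner ℝ (f x) (φ x) := by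
  rw [L2.inner_def]
  refine integral_congr_ae ?_
  filter_upwards [coeFn_testL2 φ] with x hx
  rw [hx]

theorem smooth_testFunction {Ω : Opens E3} (φ : 𝓓(Ω, F)) : ContDiff ℝ ((⊤ : ℕ∞) : WithTop ℕ∞) φ :=
  φ.contDiff

theorem differentiable_testFunction {Ω : Opens E3} (φ : 𝓓(Ω, F)) : Differentiable ℝ φ :=
  (smooth_testFunction φ).differentiable (by simp)

/-- The product of a scalar test function and a constant vector. -/
def smulConstTest {Ω : Opens E3} (g : 𝓓(Ω, ℝ)) (c : F) : 𝓓(Ω, F) :=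
  TestFunction.postcompCLM (𝕜 := ℝ) ((ContinuousLinearMap.id ℝ ℝ).smulRight c) g

@[simp]
theorem smulConstTest_apply {Ω : Opens E3} (g : 𝓓(Ω, ℝ)) (c : F) (x : E3) :
    smulConstTest g c x = g x • c := rfl

/-- The fundamental lemma of the calculus of variations, for vector-valued `L²` functions. -/
theorem eq_zero_of_forall_inner_testL2 [CompleteSpace F] {Ω : Opens E3} {f : Lp F 2 (vol Ω)}
    (h : ∀ φ : 𝓓(Ω, F), inner ℝ f (testL2 Ω φ) = 0) : f = 0 := by
  have hloc : LocallyIntegrableOn f (Ω : Set E3) volume := by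
    intro x hx
    obtain ⟨K, hK, hKx, hKΩ⟩ : ∃ K : Set E3, IsCompact K ∧ K ∈ 𝓝 x ∧ K ⊆ Ω := by
      obtain ⟨K, h1, h2, h3⟩ := local_compact_nhds (Ω.isOpen.mem_nhds hx)
      exact ⟨K, h3, h1, h2⟩
    refine ⟨K, mem_nhdsWithin_of_mem_nhds hKx, ?_⟩
    have h1 : MemLp f 2 (volume.restrict K) :=
      (Lp.memLp f).mono_measure (Measure.restrict_mono hKΩ le_rfl)
    have : IsFiniteMeasure (volume.restrict K) := ⟨by simpa using hK.measure_lt_top⟩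
    exact h1.integrable (by norm_num)
  have key := Ω.isOpen.ae_eq_zero_of_integral_contDiff_smul_eq_zero (μ := volume) hloc ?_
  · rw [Lp.eq_zero_iff_ae_eq_zero]
    exact (ae_restrict_iff' Ω.isOpen.measurableSet).2 key
  intro g hg hgc hgΩ
  let G : 𝓓(Ω, ℝ) := ⟨g, hg, hgc, hgΩ⟩
  have hint : IntegrableOn (fun x => g x • f x) (Ω : Set E3) := by
    have : MemLp (fun x => g x • f x) 1 (vol Ω) :=
      (Lp.memLp f).smul (memLp_testFunction Ω 2 G)
    exact memLp_one_iff_integrable.1 this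
  have hset : ∫ x, g x • f x = ∫ x in (Ω : Set E3), g x • f x := by
    rw [setIntegral_eq_integral_of_forall_compl_eq_zero]
    intro x hx
    rw [image_eq_zero_of_notMem_tsupport (fun h' => hx (hgΩ h')), zero_smul]
  rw [hset]
  refine ext_inner_right ℝ fun c => ?_
  rw [inner_zero_left, real_inner_comm, ← integral_inner hint, ← h (smulConstTest G c),
    inner_testL2]
  refine integral_congr_ae (Eventually.of_forall fun x => ?_)
  change inner ℝ c (g x • f x) = inner ℝ (f x) (g x • c)
  rw [inner_smul_right, inner_smul_right, real_inner_comm]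

/-- Test functions are dense in `L²(Ω)`. -/
theorem dense_range_testL2 [CompleteSpace F] (Ω : Opens E3) :
    (LinearMap.range (testL2 (F := F) Ω)).topologicalClosure = ⊤ := by
  rw [Submodule.topologicalClosure_eq_top_iff, Submodule.eq_bot_iff]
  intro f hf
  refine eq_zero_of_forall_inner_testL2 fun φ => ?_
  rw [real_inner_comm]
  exact (Submodule.mem_orthogonal _ _).1 hf _ ⟨φ, rfl⟩

theorem testL2_injective (Ω : Opens E3) : Function.Injective (testL2 (F := F) Ω) := by
  rw [injective_iff_map_eq_zero]
  intro φ hφ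
  have h1 : (φ : E3 → F) =ᵐ[vol Ω] (fun _ => 0) := by
    refine (coeFn_testL2 φ).symm.trans ?_
    rw [hφ]
    exact Lp.coeFn_zero _ _ _
  have h2 := Measure.eqOn_open_of_ae_eq h1 Ω.isOpen φ.continuous.continuousOn
    continuous_const.continuousOn
  ext x
  by_cases hx : x ∈ Ω
  · exact h2 hx
  · exact image_eq_zero_of_notMem_tsupport (fun h' => hx (φ.tsupport_subset h'))

/-- The norm of an `L²` function is determined by its pairings with test functions. -/
theorem norm_le_of_forall_inner_testL2_le [CompleteSpace F] {Ω : Opens E3} {f : Lp F 2 (vol Ω)}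
    {c : ℝ} (hc : 0 ≤ c) (h : ∀ φ : 𝓓(Ω, F), inner ℝ f (testL2 Ω φ) ≤ c * ‖testL2 Ω φ‖) :
    ‖f‖ ≤ c := by
  have hcl : IsClosed {g : Lp F 2 (vol Ω) | inner ℝ f g ≤ c * ‖g‖} :=
    isClosed_le (by fun_prop) (by fun_prop)
  have hsub : (LinearMap.range (testL2 (F := F) Ω) : Set (Lp F 2 (vol Ω))) ⊆
      {g : Lp F 2 (vol Ω) | inner ℝ f g ≤ c * ‖g‖} := by
    rintro _ ⟨φ, rfl⟩
    exact h φ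
  have hf : f ∈ (LinearMap.range (testL2 (F := F) Ω)).topologicalClosure := by
    rw [dense_range_testL2]; trivial
  have h3 : inner ℝ f f ≤ c * ‖f‖ := closure_minimal hsub hcl hf
  rw [real_inner_self_eq_norm_sq] at h3
  by_cases h0 : ‖f‖ = 0
  · rwa [h0]
  · have : 0 < ‖f‖ := lt_of_le_of_ne (norm_nonneg _) (Ne.symm h0)
    nlinarith

end TestFunctions

/-! ### Differential operators on test functions -/

/-- The `k`-th partial derivative of a test function, as a test function. -/
def partialTest {Ω : Opens E3} (k : Fin 3) : 𝓓(Ω, ℝ) →L[ℝ] 𝓓(Ω, ℝ) :=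
  TestFunction.lineDerivCLM ℝ (EuclideanSpace.single k (1 : ℝ))

theorem fderivCLM_top_apply {F : Type} [NormedAddCommGroup F] [NormedSpace ℝ F] {Ω : Opens E3}
    (φ : 𝓓(Ω, F)) (x : E3) :
    (TestFunction.fderivCLM ℝ ⊤ ⊤ φ : 𝓓(Ω, E3 →L[ℝ] F)) x = fderiv ℝ φ x := by
  rw [TestFunction.fderivCLM_apply_of_le]
  simp

theorem partialTest_apply {Ω : Opens E3} (k : Fin 3) (φ : 𝓓(Ω, ℝ)) (x : E3) :
    partialTest k φ x = partialDeriv k φ x := by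
  rw [partialTest, TestFunction.lineDerivCLM_eq_fderivCLM, fderivCLM_top_apply]
  rfl

/-- The Riesz isomorphism, from linear forms to vectors. -/
def dualToVec : (E3 →L[ℝ] ℝ) →L[ℝ] E3 where
  toFun L := (InnerProductSpace.toDual ℝ E3).symm L
  map_add' _ _ := map_add _ _ _
  map_smul' _ _ := by simp
  cont := (InnerProductSpace.toDual ℝ E3).symm.continuous

/-- The gradient of a scalar test function, as a vector-valued test function. -/
def gradTest {Ω : Opens E3} : 𝓓(Ω, ℝ) →L[ℝ] 𝓓(Ω, E3) :=
  TestFunction.postcompCLM dualToVec ∘L TestFunction.fderivCLM ℝ ⊤ ⊤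

theorem gradTest_apply {Ω : Opens E3} (φ : 𝓓(Ω, ℝ)) (x : E3) :
    gradTest φ x = gradient φ x := by
  change (InnerProductSpace.toDual ℝ E3).symm
    ((TestFunction.fderivCLM ℝ ⊤ ⊤ φ : 𝓓(Ω, E3 →L[ℝ] ℝ)) x) = _
  rw [fderivCLM_top_apply]
  rfl

theorem gradient_apply_eq_partialDeriv (φ : E3 → ℝ) (x : E3) (k : Fin 3) :
    gradient φ x k = partialDeriv k φ x := by
  have h : inner ℝ (gradient φ x) (EuclideanSpace.single k (1 : ℝ)) =
      fderiv ℝ φ x (EuclideanSpace.single k (1 : ℝ)) := by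
    rw [gradient, InnerProductSpace.toDual_symm_apply]
  rw [EuclideanSpace.inner_single_right] at h
  simpa [partialDeriv] using h

theorem gradTest_apply_apply {Ω : Opens E3} (φ : 𝓓(Ω, ℝ)) (x : E3) (k : Fin 3) :
    gradTest φ x k = partialTest k φ x := by
  rw [gradTest_apply, gradient_apply_eq_partialDeriv, partialTest_apply]

/-- The algebraic part of the curl: the axial vector of a Jacobian. -/
def axial : (E3 →L[ℝ] E3) →L[ℝ] E3 :=
  LinearMap.toContinuousLinearMap
    { toFun := fun L =>
        !₂[L (EuclideanSpace.single 1 1) 2 - L (EuclideanSpace.single 2 1) 1,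
           L (EuclideanSpace.single 2 1) 0 - L (EuclideanSpace.single 0 1) 2,
           L (EuclideanSpace.single 0 1) 1 - L (EuclideanSpace.single 1 1) 0]
      map_add' := fun L L' => by
        ext i; fin_cases i <;> simp <;> ring
      map_smul' := fun c L => by
        ext i; fin_cases i <;> simp <;> ring }

/-- The curl of a vector-valued test function, as a test function. -/
def curlTest {Ω : Opens E3} : 𝓓(Ω, E3) →L[ℝ] 𝓓(Ω, E3) :=
  TestFunction.postcompCLM axial ∘L TestFunction.fderivCLM ℝ ⊤ ⊤

theorem curlTest_apply {Ω : Opens E3} (φ : 𝓓(Ω, E3)) (x : E3) :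
    curlTest φ x = classicalCurl φ x := by
  change axial ((TestFunction.fderivCLM ℝ ⊤ ⊤ φ : 𝓓(Ω, E3 →L[ℝ] E3)) x) = _
  rw [fderivCLM_top_apply]
  rfl

/-- The `i`-th component of a vector-valued test function. -/
def compTest {Ω : Opens E3} (i : Fin 3) : 𝓓(Ω, E3) →L[ℝ] 𝓓(Ω, ℝ) :=
  TestFunction.postcompCLM (EuclideanSpace.proj (𝕜 := ℝ) i)

@[simp]
theorem compTest_apply {Ω : Opens E3} (i : Fin 3) (φ : 𝓓(Ω, E3)) (x : E3) :
    compTest i φ x = φ x i := rfl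

theorem partialDeriv_apply {Ω : Opens E3} (k i : Fin 3) (φ : 𝓓(Ω, E3)) (x : E3) :
    partialDeriv k φ x i = partialTest k (compTest i φ) x := by
  rw [partialTest_apply, partialDeriv, partialDeriv]
  have : (compTest i φ : E3 → ℝ) = (EuclideanSpace.proj (𝕜 := ℝ) i : E3 →L[ℝ] ℝ) ∘ φ := rfl
  rw [this, fderiv_comp x (ContinuousLinearMap.differentiableAt _)
    (differentiable_testFunction φ x), ContinuousLinearMap.fderiv]
  rfl

theorem curlTest_eq {Ω : Opens E3} (φ : 𝓓(Ω, E3)) (x : E3) :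
    curlTest φ x =
      !₂[partialTest 1 (compTest 2 φ) x - partialTest 2 (compTest 1 φ) x,
         partialTest 2 (compTest 0 φ) x - partialTest 0 (compTest 2 φ) x,
         partialTest 0 (compTest 1 φ) x - partialTest 1 (compTest 0 φ) x] := by
  rw [curlTest_apply, classicalCurl]
  simp only [partialDeriv_apply]

theorem partialTest_comm {Ω : Opens E3} (j k : Fin 3) (φ : 𝓓(Ω, ℝ)) :
    partialTest j (partialTest k φ) = partialTest k (partialTest j φ) := by
  ext x
  have h : ∀ a b : Fin 3, partialTest a (partialTest b φ) x =
      fderiv ℝ (fderiv ℝ φ) x (EuclideanSpace.single a 1) (EuclideanSpace.single b 1) := by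
    intro a b
    rw [partialTest_apply, partialDeriv]
    have hb : (partialTest b φ : E3 → ℝ) =
        fun y => fderiv ℝ φ y (EuclideanSpace.single b 1) := by
      ext y; rw [partialTest_apply]; rfl
    have hd : DifferentiableAt ℝ (fderiv ℝ φ) x :=
      ((smooth_testFunction φ).fderiv_right (m := 1)
        (by simp [one_add_one_eq_two]; exact WithTop.coe_le_coe.2 le_top)).differentiable
        (by simp) x
    rw [hb, fderiv_clm_apply hd (differentiableAt_const _)]
    simp
  rw [h, h]
  have hs : IsSymmSndFDerivAt ℝ φ x :=
    (smooth_testFunction φ).contDiffAt.isSymmSndFDerivAt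
      (by simp; exact WithTop.coe_le_coe.2 le_top)
  exact hs _ _

theorem curlTest_gradTest {Ω : Opens E3} (ψ : 𝓓(Ω, ℝ)) : curlTest (gradTest ψ) = 0 := by
  have h : ∀ i, compTest i (gradTest ψ) = partialTest i ψ := by
    intro i; ext x; rw [compTest_apply, gradTest_apply_apply]
  ext x i
  rw [curlTest_eq]
  simp only [h]
  rw [partialTest_comm 1 2, partialTest_comm 2 0, partialTest_comm 0 1]
  fin_cases i <;> simp

theorem integral_mul_partialTest {Ω : Opens E3} (k : Fin 3) (φ ψ : 𝓓(Ω, ℝ)) :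
    ∫ x in (Ω : Set E3), φ x * partialTest k ψ x =
      - ∫ x in (Ω : Set E3), partialTest k φ x * ψ x := by
  have hs : ∀ f : 𝓓(Ω, ℝ), ∀ g : E3 → ℝ, ∫ x in (Ω : Set E3), f x * g x = ∫ x, f x * g x := by
    intro f g
    refine setIntegral_eq_integral_of_forall_compl_eq_zero fun x hx => ?_
    rw [image_eq_zero_of_notMem_tsupport (fun h' => hx (f.tsupport_subset h')), zero_mul]
  have hi : ∀ f g : 𝓓(Ω, ℝ), Integrable (fun x => f x * g x) := fun f g =>
    (f.continuous.mul g.continuous).integrable_of_hasCompactSupport f.hasCompactSupport.mul_right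
  rw [hs, hs]
  have hp : ∀ f : 𝓓(Ω, ℝ), ∀ x, partialTest k f x = fderiv ℝ f x (EuclideanSpace.single k 1) :=
    fun f x => partialTest_apply k f x
  simp only [hp]
  refine integral_mul_fderiv_eq_neg_fderiv_mul_of_integrable ?_ ?_ (hi _ _)
    (fun x _ => differentiable_testFunction φ x) (fun x _ => differentiable_testFunction ψ x)
  · simpa only [hp] using hi (partialTest k φ) ψ
  · simpa only [hp] using hi φ (partialTest k ψ)

/-- The curl is symmetric on test fields. -/
theorem inner_testL2_curlTest {Ω : Opens E3} (φ η : 𝓓(Ω, E3)) :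
    inner ℝ (testL2 Ω φ) (testL2 Ω (curlTest η)) =
      inner ℝ (testL2 Ω (curlTest φ)) (testL2 Ω η) := by
  have hi : ∀ f g : 𝓓(Ω, ℝ), Integrable (fun x => f x * g x) (vol Ω) := fun f g =>
    ((f.continuous.mul g.continuous).integrable_of_hasCompactSupport
      f.hasCompactSupport.mul_right).restrict
  have hL : ∀ φ η : 𝓓(Ω, E3), inner ℝ (testL2 Ω φ) (testL2 Ω η) =
      ∫ x in (Ω : Set E3), inner ℝ (φ x) (η x) := by
    intro φ η
    rw [inner_testL2]
    refine integral_congr_ae ?_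
    filter_upwards [coeFn_testL2 φ] with x hx
    rw [hx]
  have e1 : ∀ φ η : 𝓓(Ω, E3), inner ℝ (testL2 Ω φ) (testL2 Ω (curlTest η)) =
      (∫ x in (Ω : Set E3), compTest 0 φ x * partialTest 1 (compTest 2 η) x)
      - (∫ x in (Ω : Set E3), compTest 0 φ x * partialTest 2 (compTest 1 η) x)
      + ((∫ x in (Ω : Set E3), compTest 1 φ x * partialTest 2 (compTest 0 η) x)
      - (∫ x in (Ω : Set E3), compTest 1 φ x * partialTest 0 (compTest 2 η) x))
      + ((∫ x in (Ω : Set E3), compTest 2 φ x * partialTest 0 (compTest 1 η) x)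
      - (∫ x in (Ω : Set E3), compTest 2 φ x * partialTest 1 (compTest 0 η) x)) := by
    intro φ η
    have hd : ∀ f g f' g' : 𝓓(Ω, ℝ), Integrable (fun x => f x * g x - f' x * g' x) (vol Ω) :=
      fun f g f' g' => (hi f g).sub (hi f' g')
    rw [hL]
    simp only [← integral_sub (hi _ _) (hi _ _)]
    rw [← integral_add (hd _ _ _ _) (hd _ _ _ _),
      ← integral_add (by exact (hd _ _ _ _).add (hd _ _ _ _)) (hd _ _ _ _)]
    refine integral_congr_ae (Eventually.of_forall fun x => ?_)
    simp only [curlTest_eq, PiLp.inner_apply, Fin.sum_univ_three, compTest_apply]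
    simp
    ring
  rw [real_inner_comm, real_inner_comm, e1, real_inner_comm, e1]
  have key : ∀ (a b k : Fin 3),
      ∫ x in (Ω : Set E3), compTest a φ x * partialTest k (compTest b η) x =
      - ∫ x in (Ω : Set E3), compTest b η x * partialTest k (compTest a φ) x := by
    intro a b k
    rw [integral_mul_partialTest]
    congr 1
    refine integral_congr_ae (Eventually.of_forall fun x => ?_)
    exact mul_comm _ _
  simp only [key]
  ring

/-! ### Weak convergence in Hilbert spaces -/

section WeakConvergence

variable {H : Type*} [NormedAddCommGroup H] [InnerProductSpace ℝ H]
variable {H' : Type*} [NormedAddCommGroup H'] [InnerProductSpace ℝ H']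

/-- Weak convergence of a sequence in a real inner product space. -/
def WeakTendsto (x : ℕ → H) (a : H) : Prop :=
  ∀ y, Tendsto (fun n => inner ℝ (x n) y) atTop (𝓝 (inner ℝ a y))

theorem WeakTendsto.comp {x : ℕ → H} {a : H} (h : WeakTendsto x a) {s : ℕ → ℕ}
    (hs : StrictMono s) : WeakTendsto (x ∘ s) a :=
  fun y => (h y).comp hs.tendsto_atTop

theorem WeakTendsto.sub_const {x : ℕ → H} {a : H} (h : WeakTendsto x a) (b : H) :
    WeakTendsto (fun n => x n - b) (a - b) := fun y => by
  simpa only [inner_sub_left] using (h y).sub_const _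

theorem WeakTendsto.sub {x x' : ℕ → H} {a a' : H} (h : WeakTendsto x a) (h' : WeakTendsto x' a') :
    WeakTendsto (fun n => x n - x' n) (a - a') := fun y => by
  simpa only [inner_sub_left] using (h y).sub (h' y)

theorem WeakTendsto.map [CompleteSpace H] [CompleteSpace H'] {x : ℕ → H} {a : H}
    (h : WeakTendsto x a) (A : H →L[ℝ] H') : WeakTendsto (fun n => A (x n)) (A a) := fun y => by
  simpa only [← ContinuousLinearMap.adjoint_inner_right] using h (A.adjoint y)

/-- Closed subspaces are weakly sequentially closed. -/
theorem WeakTendsto.mem [CompleteSpace H] {x : ℕ → H} {a : H} (h : WeakTendsto x a)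
    {K : Submodule ℝ H} (hK : IsClosed (K : Set H)) (hx : ∀ n, x n ∈ K) : a ∈ K := by
  have : CompleteSpace K := hK.completeSpace_coe
  rw [← Submodule.orthogonal_orthogonal K, Submodule.mem_orthogonal]
  intro y hy
  have h0 : ∀ n, inner ℝ (x n) y = 0 := fun n => (Submodule.mem_orthogonal _ _).1 hy _ (hx n)
  rw [real_inner_comm]
  refine tendsto_nhds_unique (h y) ?_
  simp only [h0]
  exact tendsto_const_nhds

/-- The inner product is sequentially continuous for bounded weak convergence in one argument and
strong convergence in the other. -/
theorem WeakTendsto.inner_tendsto {x y : ℕ → H} {a b : H} (h : WeakTendsto x a)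
    {B : ℝ} (hB : ∀ n, ‖x n‖ ≤ B) (hy : Tendsto y atTop (𝓝 b)) :
    Tendsto (fun n => inner ℝ (x n) (y n)) atTop (𝓝 (inner ℝ a b)) := by
  have h1 : Tendsto (fun n => inner ℝ (x n) (y n - b)) atTop (𝓝 0) := by
    have hyb : Tendsto (fun n => B * ‖y n - b‖) atTop (𝓝 0) := by
      have := (tendsto_iff_norm_sub_tendsto_zero.1 hy).const_mul B
      simpa using this
    refine squeeze_zero_norm (fun n => ?_) hyb
    exact (norm_inner_le_norm _ _).trans (mul_le_mul_of_nonneg_right (hB n) (norm_nonneg _))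
  have h2 := h1.add (h b)
  simpa only [inner_sub_right, sub_add_cancel, zero_add] using h2

theorem weakTendsto_of_tendsto {x : ℕ → H} {a : H} (h : Tendsto x atTop (𝓝 a)) :
    WeakTendsto x a := fun _ => h.inner tendsto_const_nhds

/-- Bounded sequences in a separable Hilbert space have weakly convergent subsequences. -/
theorem exists_subseq_weakTendsto [CompleteSpace H] [SeparableSpace H] {x : ℕ → H} {B : ℝ}
    (hB : ∀ n, ‖x n‖ ≤ B) : ∃ a, ∃ s : ℕ → ℕ, StrictMono s ∧ WeakTendsto (x ∘ s) a := by
  let y : ℕ → WeakDual ℝ H := fun n =>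
    StrongDual.toWeakDual (InnerProductSpace.toDual ℝ H (x n))
  have hy : ∀ n, y n ∈ WeakDual.toStrongDual ⁻¹' Metric.closedBall (0 : StrongDual ℝ H) B := by
    intro n
    rw [Set.mem_preimage, mem_closedBall_zero_iff]
    change ‖InnerProductSpace.toDual ℝ H (x n)‖ ≤ B
    rw [LinearIsometryEquiv.norm_map]
    exact hB n
  obtain ⟨a, -, s, hs, hlim⟩ := WeakDual.isSeqCompact_closedBall ℝ H 0 B hy
  refine ⟨(InnerProductSpace.toDual ℝ H).symm (WeakDual.toStrongDual a), s, hs, fun v => ?_⟩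
  have h1 := ((WeakDual.eval_continuous v).tendsto a).comp hlim
  rw [InnerProductSpace.toDual_symm_apply]
  exact h1

end WeakConvergence

/-! ### The differential operators in terms of inner products -/

theorem hasWeakCurl_iff {Ω : Opens E3} {u w : VecL2 Ω} :
    HasWeakCurl Ω u w ↔
      ∀ φ : 𝓓(Ω, E3), inner ℝ u (testL2 Ω (curlTest φ)) = inner ℝ w (testL2 Ω φ) := by
  simp only [HasWeakCurl, inner_testL2, curlTest_apply]

theorem curl_eq {Ω : Opens E3} {u w : VecL2 Ω} (h : HasWeakCurl Ω u w) : curl Ω u = w := by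
  have hex : ∃ w, HasWeakCurl Ω u w := ⟨w, h⟩
  rw [curl, dif_pos hex, ← sub_eq_zero]
  refine eq_zero_of_forall_inner_testL2 fun φ => ?_
  rw [inner_sub_left, ← hasWeakCurl_iff.1 h, ← hasWeakCurl_iff.1 hex.choose_spec, sub_self]

/-- The map `φ ↦ (φ, curl φ)` on test fields. -/
def testCurlPair (Ω : Opens E3) : 𝓓(Ω, E3) →ₗ[ℝ] WithLp 2 (VecL2 Ω × VecL2 Ω) :=
  (WithLp.linearEquiv 2 ℝ (VecL2 Ω × VecL2 Ω)).symm.toLinearMap ∘ₗ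
    (testL2 Ω).prod (testL2 Ω ∘ₗ curlTest.toLinearMap)

/-- The graph of the curl on `H₀(curl, Ω)`: the closure of the pairs `(φ, curl φ)`. -/
def curlGraph (Ω : Opens E3) : Submodule ℝ (WithLp 2 (VecL2 Ω × VecL2 Ω)) :=
  (LinearMap.range (testCurlPair Ω)).topologicalClosure

/-- Integration by parts passes to the closure of the test fields. -/
theorem hasWeakCurl_of_mem_curlGraph {Ω : Opens E3} {u w : VecL2 Ω}
    (h : WithLp.toLp 2 (u, w) ∈ curlGraph Ω) : HasWeakCurl Ω u w := by
  rw [hasWeakCurl_iff]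
  intro η
  have hcl : IsClosed {p : WithLp 2 (VecL2 Ω × VecL2 Ω) |
      inner ℝ p.fst (testL2 Ω (curlTest η)) = inner ℝ p.snd (testL2 Ω η)} :=
    isClosed_eq (by fun_prop) (by fun_prop)
  refine closure_minimal ?_ hcl h
  rintro _ ⟨φ, rfl⟩
  exact inner_testL2_curlTest φ η

theorem edist_testL2 {F : Type} [NormedAddCommGroup F] [InnerProductSpace ℝ F] {Ω : Opens E3}
    (u : Lp F 2 (vol Ω)) (φ : 𝓓(Ω, F)) :
    edist u (testL2 Ω φ) = eLpNorm (fun x => u x - φ x) 2 (vol Ω) := by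
  rw [Lp.edist_def]
  refine eLpNorm_congr_ae ?_
  filter_upwards [coeFn_testL2 φ] with x hx
  rw [Pi.sub_apply, hx]

theorem mem_curlGraph_of_mem_HCurlZero {Ω : Opens E3} {u : VecL2 Ω} (h : u ∈ HCurlZero Ω) :
    WithLp.toLp 2 (u, curl Ω u) ∈ curlGraph Ω := by
  obtain ⟨-, φ, h1, h2⟩ := h
  have t1 : Tendsto (fun n => testL2 Ω (φ n)) atTop (𝓝 u) := by
    rw [tendsto_iff_edist_tendsto_0]
    simpa only [edist_comm _ u, edist_testL2] using h1
  have t2 : Tendsto (fun n => testL2 Ω (curlTest (φ n))) atTop (𝓝 (curl Ω u)) := by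
    rw [tendsto_iff_edist_tendsto_0]
    simpa only [edist_comm _ (curl Ω u), edist_testL2, curlTest_apply] using h2
  have t3 : Tendsto (fun n => testCurlPair Ω (φ n)) atTop (𝓝 (WithLp.toLp 2 (u, curl Ω u))) :=
    ((WithLp.prod_continuous_toLp 2 _ _).tendsto (u, curl Ω u)).comp (t1.prodMk_nhds t2)
  exact mem_closure_of_tendsto t3 (Eventually.of_forall fun n => ⟨φ n, rfl⟩)

theorem mem_HCurlZero_of_mem_curlGraph {Ω : Opens E3} {u w : VecL2 Ω}
    (h : WithLp.toLp 2 (u, w) ∈ curlGraph Ω) : u ∈ HCurlZero Ω := by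
  have hw := hasWeakCurl_of_mem_curlGraph h
  obtain ⟨p, hp, hlim⟩ := mem_closure_iff_seq_limit.1 h
  choose φ hφ using hp
  have t1 : Tendsto (fun n => testL2 Ω (φ n)) atTop (𝓝 u) := by
    have := ((WithLp.prod_continuous_ofLp 2 _ _).fst.tendsto _).comp hlim
    refine this.congr fun n => ?_
    rw [Function.comp_apply, ← hφ n]; rfl
  have t2 : Tendsto (fun n => testL2 Ω (curlTest (φ n))) atTop (𝓝 w) := by
    have := ((WithLp.prod_continuous_ofLp 2 _ _).snd.tendsto _).comp hlim
    refine this.congr fun n => ?_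
    rw [Function.comp_apply, ← hφ n]; rfl
  refine ⟨⟨w, hw⟩, φ, ?_, ?_⟩
  · rw [tendsto_iff_edist_tendsto_0] at t1
    simpa only [edist_comm _ u, edist_testL2] using t1
  · rw [curl_eq hw]
    rw [tendsto_iff_edist_tendsto_0] at t2
    simpa only [edist_comm _ w, edist_testL2, curlTest_apply] using t2

theorem testL2_mem_curlGraph {Ω : Opens E3} (φ : 𝓓(Ω, E3)) :
    WithLp.toLp 2 (testL2 Ω φ, testL2 Ω (curlTest φ)) ∈ curlGraph Ω :=
  Submodule.le_topologicalClosure _ ⟨φ, rfl⟩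

theorem hasWeakPartial_iff {Ω : Opens E3} {k : Fin 3} {f g : ScalL2 Ω} :
    HasWeakPartial Ω k f g ↔
      ∀ φ : 𝓓(Ω, ℝ), inner ℝ f (testL2 Ω (partialTest k φ)) = - inner ℝ g (testL2 Ω φ) := by
  simp only [HasWeakPartial, inner_testL2, partialTest_apply, real_inner_eq_re_inner]
  simp [mul_comm]

/-! ### Multiplication by the permittivity -/

/-- The action of a matrix on `E3`, as a continuous linear map. -/
def matCLM (M : Matrix (Fin 3) (Fin 3) ℝ) : E3 →L[ℝ] E3 :=
  Matrix.toEuclideanCLM (𝕜 := ℝ) M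

theorem mdot_eq_inner (M : Matrix (Fin 3) (Fin 3) ℝ) (ξ η : E3) :
    mdot M ξ η = inner ℝ (matCLM M ξ) η := by
  rw [mdot, EuclideanSpace.inner_eq_star_dotProduct, dotProduct_comm]
  simp [matCLM]

section Permittivity

variable {Ω : Opens E3} {ε : E3 → Matrix (Fin 3) (Fin 3) ℝ}

theorem memLp_sum_smul {G : Type} [NormedAddCommGroup G] [NormedSpace ℝ G]
    (hb : ∀ i j, MemLp (fun x => ε x i j) ∞ (vol Ω)) (A : Fin 3 → Fin 3 → G) :
    MemLp (fun x => ∑ i, ∑ j, ε x i j • A i j) ∞ (vol Ω) := by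
  have h1 : ∀ i j, MemLp (fun x => ε x i j • A i j) ∞ (vol Ω) :=
    fun i j => ((ContinuousLinearMap.id ℝ ℝ).smulRight (A i j)).comp_memLp' (hb i j)
  have h2 : ∀ i, MemLp (fun x => ∑ j, ε x i j • A i j) ∞ (vol Ω) :=
    fun i => memLp_finsetSum Finset.univ fun j _ => h1 i j
  exact memLp_finsetSum Finset.univ fun i _ => h2 i

theorem memLp_matCLM (hb : ∀ i j, MemLp (fun x => ε x i j) ∞ (vol Ω)) :
    MemLp (fun x => matCLM (ε x)) ∞ (vol Ω) := by
  have h : (fun x => matCLM (ε x)) =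
      fun x => ∑ i, ∑ j, ε x i j • matCLM (Matrix.single i j 1) := by
    ext1 x
    conv_lhs => rw [Matrix.matrix_eq_sum_single (ε x)]
    simp only [matCLM, map_sum, ← map_smul, Matrix.smul_single, smul_eq_mul, mul_one]
  rw [h]
  exact memLp_sum_smul hb fun i j => matCLM (Matrix.single i j 1)

/-- Multiplication by a bounded matrix field, as a bounded operator on `L²(Ω)³`. -/
def epsOp (hb : ∀ i j, MemLp (fun x => ε x i j) ∞ (vol Ω)) : VecL2 Ω →L[ℝ] VecL2 Ω :=
  (ContinuousLinearMap.id ℝ (E3 →L[ℝ] E3)).holderL (vol Ω) ∞ 2 2 ((memLp_matCLM hb).toLp _)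

theorem coeFn_epsOp (hb : ∀ i j, MemLp (fun x => ε x i j) ∞ (vol Ω)) (u : VecL2 Ω) :
    epsOp hb u =ᵐ[vol Ω] fun x => matCLM (ε x) (u x) := by
  have h := (ContinuousLinearMap.id ℝ (E3 →L[ℝ] E3)).coeFn_holder (r := 2)
    ((memLp_matCLM hb).toLp _) u
  filter_upwards [h, (memLp_matCLM hb).coeFn_toLp] with x h1 h2
  change _ = _ at h1
  rw [← h2]
  exact h1

theorem innerEps_eq (hb : ∀ i j, MemLp (fun x => ε x i j) ∞ (vol Ω)) (u v : VecL2 Ω) :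
    innerEps Ω ε u v = inner ℝ (epsOp hb u) v := by
  rw [innerEps, L2.inner_def]
  refine integral_congr_ae ?_
  filter_upwards [coeFn_epsOp hb u] with x hx
  rw [hx, mdot_eq_inner]

theorem hasWeakDiv_iff (hb : ∀ i j, MemLp (fun x => ε x i j) ∞ (vol Ω)) {u : VecL2 Ω}
    {d : ScalL2 Ω} :
    HasWeakDiv Ω ε u d ↔ ∀ φ : 𝓓(Ω, ℝ),
      inner ℝ (epsOp hb u) (testL2 Ω (gradTest φ)) = - inner ℝ d (testL2 Ω φ) := by
  refine forall_congr' fun φ => ?_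
  have h1 : ∫ x in (Ω : Set E3), mdot (ε x) (u x) (gradient φ x) =
      inner ℝ (epsOp hb u) (testL2 Ω (gradTest φ)) := by
    rw [inner_testL2]
    refine integral_congr_ae ?_
    filter_upwards [coeFn_epsOp hb u] with x hx
    rw [hx, mdot_eq_inner, gradTest_apply]
  have h2 : ∫ x in (Ω : Set E3), d x * φ x = inner ℝ d (testL2 Ω φ) := by
    rw [inner_testL2]
    simp [mul_comm]
  rw [h1, h2]

theorem divEps_eq (hb : ∀ i j, MemLp (fun x => ε x i j) ∞ (vol Ω)) {u : VecL2 Ω}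
    {d : ScalL2 Ω} (h : HasWeakDiv Ω ε u d) : divEps Ω ε u = d := by
  have hex : ∃ d, HasWeakDiv Ω ε u d := ⟨d, h⟩
  rw [divEps, dif_pos hex, ← sub_eq_zero]
  refine eq_zero_of_forall_inner_testL2 fun φ => ?_
  have h1 := (hasWeakDiv_iff hb).1 h φ
  have h2 := (hasWeakDiv_iff hb).1 hex.choose_spec φ
  rw [inner_sub_left]
  linarith

theorem inner_epsOp_comm (hb : ∀ i j, MemLp (fun x => ε x i j) ∞ (vol Ω))
    (hs : ∀ᵐ x ∂(vol Ω), (ε x).IsSymm) (u v : VecL2 Ω) :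
    inner ℝ (epsOp hb u) v = inner ℝ (epsOp hb v) u := by
  rw [← innerEps_eq, ← innerEps_eq]
  refine integral_congr_ae ?_
  filter_upwards [hs] with x hx
  rw [mdot, mdot, dotProduct_comm, Matrix.dotProduct_mulVec, ← Matrix.mulVec_transpose, hx]

theorem le_inner_epsOp (hb : ∀ i j, MemLp (fun x => ε x i j) ∞ (vol Ω)) {c : ℝ}
    (hc : ∀ᵐ x ∂(vol Ω), ∀ ξ : E3, c * ‖ξ‖ ^ 2 ≤ mdot (ε x) ξ ξ) (u : VecL2 Ω) :
    c * ‖u‖ ^ 2 ≤ inner ℝ (epsOp hb u) u := by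
  rw [← real_inner_self_eq_norm_sq, L2.inner_def, ← innerEps_eq, innerEps, ← integral_const_mul]
  have h1 : Integrable (fun x => inner ℝ (u x) (u x)) (vol Ω) := L2.integrable_inner u u
  have h2 : Integrable (fun x => mdot (ε x) (u x) (u x)) (vol Ω) := by
    refine (L2.integrable_inner (𝕜 := ℝ) (epsOp hb u) u).congr ?_
    filter_upwards [coeFn_epsOp hb u] with x hx
    rw [hx, mdot_eq_inner]
  refine integral_mono_ae (h1.const_mul c) h2 ?_
  filter_upwards [hc] with x hx
  simpa only [real_inner_self_eq_norm_sq] using hx (u x)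

end Permittivity

/-! ### Test fields, the Poincaré inequality and constant permittivities -/

/-- The product of two scalar test functions. -/
def mulTest {Ω : Opens E3} (f g : 𝓓(Ω, ℝ)) : 𝓓(Ω, ℝ) :=
  ⟨fun x => f x * g x, (smooth_testFunction f).mul (smooth_testFunction g),
    f.hasCompactSupport.mul_right, (tsupport_mul_subset_left).trans f.tsupport_subset⟩

@[simp]
theorem mulTest_apply {Ω : Opens E3} (f g : 𝓓(Ω, ℝ)) (x : E3) : mulTest f g x = f x * g x := rfl

theorem partialTest_mulTest {Ω : Opens E3} (k : Fin 3) (f g : 𝓓(Ω, ℝ)) (x : E3) :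
    partialTest k (mulTest f g) x = f x * partialTest k g x + partialTest k f x * g x := by
  simp only [partialTest_apply, partialDeriv]
  have : (mulTest f g : E3 → ℝ) = fun x => f x * g x := rfl
  rw [this, fderiv_fun_mul (differentiable_testFunction f x) (differentiable_testFunction g x)]
  simp [mul_comm]

theorem integrable_bounded_mul_testFunction {Ω : Opens E3} {a : E3 → ℝ}
    (ha : MemLp a ∞ (vol Ω)) (f : 𝓓(Ω, ℝ)) : Integrable (fun x => a x * f x) (vol Ω) :=
  memLp_one_iff_integrable.1 ((memLp_testFunction Ω 1 f).mul ha)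

theorem memLp_bounded_mul_testFunction {Ω : Opens E3} {a : E3 → ℝ}
    (ha : MemLp a ∞ (vol Ω)) (f : 𝓓(Ω, ℝ)) : MemLp (fun x => a x * f x) 2 (vol Ω) :=
  (memLp_testFunction Ω 2 f).mul ha

/-- The product rule for the weak derivative of a bounded function times a test function. -/
theorem HasWeakPartial.integral_mul_testFunction {Ω : Opens E3} {k : Fin 3} {a b : E3 → ℝ}
    (h : HasWeakPartial Ω k a b) (ha : MemLp a ∞ (vol Ω)) (hb : MemLp b ∞ (vol Ω))
    (f g : 𝓓(Ω, ℝ)) :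
    ∫ x in (Ω : Set E3), a x * f x * partialTest k g x =
      - ∫ x in (Ω : Set E3), (b x * f x + a x * partialTest k f x) * g x := by
  have h1 := h (mulTest f g)
  simp only [← partialTest_apply, partialTest_mulTest, mulTest_apply] at h1
  have i1 : Integrable (fun x => a x * (f x * partialTest k g x)) (vol Ω) :=
    integrable_bounded_mul_testFunction ha (mulTest f (partialTest k g))
  have i2 : Integrable (fun x => a x * (partialTest k f x * g x)) (vol Ω) :=
    integrable_bounded_mul_testFunction ha (mulTest (partialTest k f) g)
  have i3 : Integrable (fun x => b x * (f x * g x)) (vol Ω) :=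
    integrable_bounded_mul_testFunction hb (mulTest f g)
  simp only [mul_add] at h1
  rw [integral_add i1 i2] at h1
  have e1 : ∫ x in (Ω : Set E3), (b x * f x + a x * partialTest k f x) * g x =
      (∫ x in (Ω : Set E3), b x * (f x * g x)) +
        ∫ x in (Ω : Set E3), a x * (partialTest k f x * g x) := by
    rw [← integral_add i3 i2]
    refine integral_congr_ae (Eventually.of_forall fun x => ?_)
    simp only; ring
  have e2 : ∫ x in (Ω : Set E3), a x * f x * partialTest k g x =
      ∫ x in (Ω : Set E3), a x * (f x * partialTest k g x) := by
    simp only [mul_assoc]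
  rw [e1, e2]
  linarith

/-- For `ε` with bounded weak derivatives, `div (ε φ)` is square integrable for every test field
`φ`. -/
theorem hasWeakDiv_testL2 {Ω : Opens E3} {ε : E3 → Matrix (Fin 3) (Fin 3) ℝ}
    (hε : IsW1inftySym Ω ε) (φ : 𝓓(Ω, E3)) : ∃ d, HasWeakDiv Ω ε (testL2 Ω φ) d := by
  choose g hg hgw using hε.exists_weakPartial
  let D : Fin 3 → Fin 3 → E3 → ℝ := fun i j x =>
    g i j i x * compTest j φ x + ε x i j * partialTest i (compTest j φ) x
  have hD : ∀ i j, MemLp (D i j) 2 (vol Ω) := fun i j =>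
    (memLp_bounded_mul_testFunction (hg i j i) _).add
      (memLp_bounded_mul_testFunction (hε.memLp i j) _)
  have hD' : MemLp (fun x => ∑ i, ∑ j, D i j x) 2 (vol Ω) :=
    memLp_finsetSum Finset.univ fun i _ => memLp_finsetSum Finset.univ fun j _ => hD i j
  refine ⟨hD'.toLp _, fun ψ => ?_⟩
  have e1 : ∫ x in (Ω : Set E3), mdot (ε x) (testL2 Ω φ x) (gradient ψ x) =
      ∫ x in (Ω : Set E3), ∑ i, ∑ j, ε x i j * compTest j φ x * partialTest i ψ x := by
    refine integral_congr_ae ?_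
    filter_upwards [coeFn_testL2 φ] with x hx
    rw [hx, mdot, dotProduct]
    refine Finset.sum_congr rfl fun i _ => ?_
    rw [Matrix.mulVec, dotProduct, Finset.sum_mul]
    refine Finset.sum_congr rfl fun j _ => ?_
    rw [compTest_apply, ← gradTest_apply_apply, gradTest_apply]
  have e2 : ∫ x in (Ω : Set E3), hD'.toLp _ x * ψ x =
      ∫ x in (Ω : Set E3), ∑ i, ∑ j, D i j x * ψ x := by
    refine integral_congr_ae ?_
    filter_upwards [hD'.coeFn_toLp] with x hx
    simp only [hx, Finset.sum_mul]
  have i1 : ∀ i j, Integrable (fun x => ε x i j * compTest j φ x * partialTest i ψ x) (vol Ω) := by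
    intro i j
    simpa only [mulTest_apply, mul_assoc] using
      integrable_bounded_mul_testFunction (hε.memLp i j) (mulTest (compTest j φ) (partialTest i ψ))
  have i2 : ∀ i j, Integrable (fun x => D i j x * ψ x) (vol Ω) := fun i j =>
    memLp_one_iff_integrable.1 ((memLp_testFunction Ω 2 ψ).mul (hD i j))
  rw [e1, e2, integral_finsetSum _ fun i _ => integrable_finsetSum _ fun j _ => i1 i j,
    integral_finsetSum _ fun i _ => integrable_finsetSum _ fun j _ => i2 i j,
    ← Finset.sum_neg_distrib]
  refine Finset.sum_congr rfl fun i _ => ?_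
  rw [integral_finsetSum _ fun j _ => i1 i j, integral_finsetSum _ fun j _ => i2 i j,
    ← Finset.sum_neg_distrib]
  refine Finset.sum_congr rfl fun j _ => ?_
  exact (hgw i j i).integral_mul_testFunction (hε.memLp i j) (hg i j i) (compTest j φ) ψ

theorem testL2_mem_XN {Ω : Opens E3} {ε : E3 → Matrix (Fin 3) (Fin 3) ℝ}
    (hε : IsW1inftySym Ω ε) (φ : 𝓓(Ω, E3)) : testL2 Ω φ ∈ XN Ω ε :=
  ⟨mem_HCurlZero_of_mem_curlGraph (testL2_mem_curlGraph φ), hasWeakDiv_testL2 hε φ⟩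

theorem norm_testL2 {F : Type} [NormedAddCommGroup F] [InnerProductSpace ℝ F] {Ω : Opens E3}
    (φ : 𝓓(Ω, F)) : ‖testL2 Ω φ‖ = (eLpNorm φ 2 volume).toReal := by
  have h1 : ‖testL2 Ω φ‖ = (eLpNorm φ 2 (vol Ω)).toReal :=
    Lp.norm_toLp _ (memLp_testFunction Ω 2 φ)
  rw [h1, eLpNorm_restrict_eq_of_support_subset ((subset_tsupport φ).trans φ.tsupport_subset)]

/-- The Poincaré inequality for test functions on a bounded open set. -/
theorem exists_norm_testL2_le_gradTest {Ω : Opens E3}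
    (hΩ : Bornology.IsBounded (Ω : Set E3)) :
    ∃ C : ℝ, 0 ≤ C ∧ ∀ ψ : 𝓓(Ω, ℝ), ‖testL2 Ω ψ‖ ≤ C * ‖testL2 Ω (gradTest ψ)‖ := by
  refine ⟨eLpNormLESNormFDerivOfLeConst ℝ volume (Ω : Set E3) 2 2, NNReal.coe_nonneg _,
    fun ψ => ?_⟩
  have h := eLpNorm_le_eLpNorm_fderiv (μ := volume) (u := ψ) (s := (Ω : Set E3)) (p := 2)
    ((smooth_testFunction ψ).of_le (by exact_mod_cast le_top))
    ((subset_tsupport ψ).trans ψ.tsupport_subset) (by norm_num) (by simp; norm_num) hΩ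
  have hg : eLpNorm (fderiv ℝ ψ) 2 volume = eLpNorm (gradTest ψ) 2 volume := by
    refine eLpNorm_congr_norm_ae (Eventually.of_forall fun x => ?_)
    rw [gradTest_apply, gradient, LinearIsometryEquiv.norm_map]
  have hfin : eLpNorm (gradTest ψ) 2 volume ≠ ⊤ :=
    ((gradTest ψ).continuous.memLp_of_hasCompactSupport (gradTest ψ).hasCompactSupport).2.ne
  rw [norm_testL2, norm_testL2]
  have h' : eLpNorm ψ 2 volume ≤ eLpNormLESNormFDerivOfLeConst ℝ volume (Ω : Set E3) 2 2 *
    eLpNorm (gradTest ψ) 2 volume := by rw [← hg]; exact h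
  have := ENNReal.toReal_mono (ENNReal.mul_ne_top ENNReal.coe_ne_top hfin) h'
  rwa [ENNReal.toReal_mul, ENNReal.coe_toReal] at this

theorem hasWeakPartial_const {Ω : Opens E3} (k : Fin 3) (a : ℝ) :
    HasWeakPartial Ω k (fun _ => a) (fun _ => 0) := by
  intro φ
  simp only [zero_mul, integral_zero, neg_zero, ← partialTest_apply]
  rw [integral_const_mul]
  have h0 : ∫ x in (Ω : Set E3), partialTest k φ x = ∫ x, partialTest k φ x := by
    refine setIntegral_eq_integral_of_forall_compl_eq_zero fun x hx => ?_
    exact image_eq_zero_of_notMem_tsupport (fun h' => hx ((partialTest k φ).tsupport_subset h'))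
  have hp : ∀ x, partialTest k φ x = fderiv ℝ φ x (EuclideanSpace.single k 1) :=
    fun x => partialTest_apply k φ x
  have hi : ∀ f : 𝓓(Ω, ℝ), Integrable f volume := fun f =>
    f.continuous.integrable_of_hasCompactSupport f.hasCompactSupport
  have h1 := integral_mul_fderiv_eq_neg_fderiv_mul_of_integrable (μ := volume)
    (f := fun _ : E3 => (1 : ℝ)) (g := φ) (v := EuclideanSpace.single k 1)
    (by simp) (by simpa [← hp] using hi (partialTest k φ)) (by simpa using hi φ)
    (fun x _ => differentiableAt_const _) (fun x _ => differentiable_testFunction φ x)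
  simp only [← hp] at h1
  rw [h0]
  simp at h1
  rw [h1, mul_zero]

/-- A constant multiple of the identity is an admissible permittivity. -/
theorem admissibleBdd_const (Ω : Opens E3) {α β γ : ℝ} (hαβ : α ≤ β) (hγ : 0 ≤ γ) :
    AdmissibleBdd Ω α β γ (fun _ => α • 1) := by
  refine ⟨⟨fun i j => memLp_top_const _, fun i j k => ⟨fun _ => 0, memLp_top_const _,
    hasWeakPartial_const k _⟩, Eventually.of_forall fun _ => by
      rw [Matrix.IsSymm, Matrix.transpose_smul, Matrix.transpose_one]⟩,
    Eventually.of_forall fun _ ξ => ?_, fun i j k => ⟨fun _ => 0, aestronglyMeasurable_const,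
      hasWeakPartial_const k _, Eventually.of_forall fun _ => by simpa using hγ⟩⟩
  have : mdot (α • 1) ξ ξ = α * ‖ξ‖ ^ 2 := by
    rw [mdot_eq_inner, matCLM, map_smul, map_one, ← real_inner_self_eq_norm_sq]
    simp [inner_smul_left]
  rw [this]
  exact ⟨le_rfl, mul_le_mul_of_nonneg_right hαβ (sq_nonneg _)⟩

/-- The test fields are not contained in a finite-dimensional space. -/
theorem exists_testL2_notMem {Ω : Opens E3} (hΩ : (Ω : Set E3).Nonempty)
    (W : Submodule ℝ (VecL2 Ω)) [FiniteDimensional ℝ W] :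
    ∃ φ : 𝓓(Ω, E3), testL2 Ω φ ∉ W := by
  by_contra! hW
  let e : E3 := EuclideanSpace.single 0 1
  let J : 𝓓(Ω, ℝ) →ₗ[ℝ] W :=
    (testL2 Ω ∘ₗ (TestFunction.postcompCLM (𝕜 := ℝ)
      ((ContinuousLinearMap.id ℝ ℝ).smulRight e)).toLinearMap).codRestrict W fun ψ => hW _
  have hJ : Function.Injective J := by
    intro f g hfg
    have h1 := testL2_injective Ω (congrArg Subtype.val hfg)
    ext x
    have h2 : (smulConstTest f e) x 0 = (smulConstTest g e) x 0 :=
      congrArg (fun φ : 𝓓(Ω, E3) => φ x 0) h1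
    simpa [e] using h2
  have hfin : FiniteDimensional ℝ 𝓓(Ω, ℝ) := FiniteDimensional.of_injective J hJ
  set n := Module.finrank ℝ 𝓓(Ω, ℝ) + 1 with hn
  have hinf : (Ω : Set E3).Infinite := by
    obtain ⟨p, hp⟩ := hΩ
    exact infinite_of_mem_nhds p (Ω.isOpen.mem_nhds hp)
  obtain ⟨t, htΩ, htn⟩ := hinf.exists_subset_card_eq n
  -- evaluation at more points than the dimension is still surjective
  let ev : 𝓓(Ω, ℝ) →ₗ[ℝ] (t → ℝ) :=
    { toFun := fun f x => f x
      map_add' := fun _ _ => rfl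
      map_smul' := fun _ _ => rfl }
  have hev : Function.Surjective ev := by
    rw [← LinearMap.range_eq_top, eq_top_iff, ← (Pi.basisFun ℝ t).span_eq, Submodule.span_le]
    rintro _ ⟨i, rfl⟩
    have hopen : IsOpen ((Ω : Set E3) \ (t.erase i : Finset E3)) :=
      Ω.isOpen.sdiff (Finset.finite_toSet _).isClosed
    obtain ⟨f, hf, hfc, hfs, -, hf1⟩ := exists_contDiff_tsupport_subset (n := ⊤) (x := (i : E3))
      (hopen.mem_nhds ⟨htΩ i.2, by simp⟩)
    refine ⟨⟨f, hfs, hfc, hf.trans Set.sdiff_subset⟩, ?_⟩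
    ext j
    rw [Pi.basisFun_apply]
    change f j = _
    by_cases hij : j = i
    · subst hij; simp [hf1]
    · rw [Pi.single_eq_of_ne hij]
      refine image_eq_zero_of_notMem_tsupport fun h' => (hf h').2 ?_
      simp only [Finset.coe_erase, Set.mem_sdiff, Finset.mem_coe, Set.mem_singleton_iff]
      exact ⟨j.2, fun h => hij (Subtype.ext h)⟩
  have := LinearMap.finrank_le_finrank_of_injective (f := ev.dualMap)
    (LinearMap.dualMap_injective_of_surjective hev)
  simp [Subspace.dual_finrank_eq, htn] at this
  omega

/-! ### Rellich compactness on bounded Lipschitz domains -/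

/-- The translate `x ↦ φ (x - v)` of a test function whose support stays in `Ω`. -/
def shiftTest {Ω : Opens E3} (φ : 𝓓(Ω, ℝ)) (v : E3) (hv : ∀ x ∈ tsupport φ, x + v ∈ Ω) :
    𝓓(Ω, ℝ) :=
  ⟨fun x => φ (x - v), (smooth_testFunction φ).comp (contDiff_id.sub contDiff_const),
    φ.hasCompactSupport.comp_homeomorph (Homeomorph.subRight v), by
      have h : tsupport (fun x => φ (x - v)) = (Homeomorph.subRight v) ⁻¹' tsupport φ :=
        tsupport_comp_eq_preimage φ (Homeomorph.subRight v)
      rw [h]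
      intro x hx
      simpa using hv _ hx⟩

theorem norm_testL2_shiftTest {Ω : Opens E3} (φ : 𝓓(Ω, ℝ)) (v : E3)
    (hv : ∀ x ∈ tsupport φ, x + v ∈ Ω) : ‖testL2 Ω (shiftTest φ v hv)‖ = ‖testL2 Ω φ‖ := by
  rw [norm_testL2, norm_testL2]
  congr 1
  exact eLpNorm_comp_measurePreserving φ.continuous.aestronglyMeasurable
    (measurePreserving_sub_right volume v)

theorem fderiv_apply_eq_sum {Ω : Opens E3} (φ : 𝓓(Ω, ℝ)) (x h : E3) :
    fderiv ℝ φ x h = ∑ k, h k * partialTest k φ x := by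
  have hsum : h = ∑ k, h k • EuclideanSpace.single k (1 : ℝ) := by
    ext i
    fin_cases i <;> simp [Fin.sum_univ_three]
  conv_lhs => rw [hsum]
  rw [map_sum]
  refine Finset.sum_congr rfl fun k _ => ?_
  rw [map_smul, partialTest_apply, smul_eq_mul]
  rfl

theorem fderiv_shiftTest {Ω : Opens E3} (φ : 𝓓(Ω, ℝ)) (v : E3)
    (hv : ∀ x ∈ tsupport φ, x + v ∈ Ω) (x : E3) :
    fderiv ℝ (shiftTest φ v hv) x = fderiv ℝ φ (x - v) :=
  fderiv_comp_sub (f := φ) v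

theorem integrable_mul_bounded {Ω : Opens E3} (hΩ : Bornology.IsBounded (Ω : Set E3))
    (f : ScalL2 Ω) {g : E3 → ℝ} (hg : Continuous g) {C : ℝ} (hC : ∀ x, ‖g x‖ ≤ C) :
    Integrable (fun x => f x * g x) (vol Ω) := by
  have : IsFiniteMeasure (vol Ω) := ⟨by simpa using hΩ.measure_lt_top⟩
  exact ((Lp.memLp f).integrable (by norm_num)).mul_bdd hg.aestronglyMeasurable
    (Eventually.of_forall hC)

/-- The difference quotient estimate for functions with a weak gradient, in dual form: moving a
test function by `h` inside `Ω` changes its pairing with `f` by at most `3 |h| B ‖φ‖`, where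
`B` bounds the weak partial derivatives. -/
theorem abs_integral_sub_shift_le {Ω : Opens E3} (hΩ : Bornology.IsBounded (Ω : Set E3))
    {f : ScalL2 Ω} {D : Fin 3 → ScalL2 Ω} (hD : ∀ k, HasWeakPartial Ω k f (D k)) {B : ℝ}
    (hB : ∀ k, ‖D k‖ ≤ B) (φ : 𝓓(Ω, ℝ)) {h : E3}
    (hh : ∀ x ∈ tsupport φ, ∀ s ∈ Set.Icc (0 : ℝ) 1, x + s • h ∈ Ω) :
    |(∫ x in (Ω : Set E3), f x * φ (x - h)) - ∫ x in (Ω : Set E3), f x * φ x| ≤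
      3 * (‖h‖ * B * ‖testL2 Ω φ‖) := by
  have : IsFiniteMeasure (vol Ω) := ⟨by simpa using hΩ.measure_lt_top⟩
  obtain ⟨C0, hC0⟩ := φ.continuous.bounded_above_of_compact_support φ.hasCompactSupport
  have hfd : Continuous (fderiv ℝ φ) := (smooth_testFunction φ).continuous_fderiv (by simp)
  obtain ⟨C1, hC1⟩ := hfd.bounded_above_of_compact_support (φ.hasCompactSupport.fderiv ℝ)
  have hsh : ∀ s : ℝ, Continuous fun x : E3 => x - s • h := fun s => by fun_prop
  -- the pairing of `f` with the translate of `φ` by `s h` is differentiable in `s`, and its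
  -- derivative is the pairing of the weak derivative of `f` along `h` with that translate
  have hder : ∀ s : ℝ, HasDerivAt (fun s : ℝ => ∫ x in (Ω : Set E3), f x * φ (x - s • h))
      (∫ x in (Ω : Set E3), f x * fderiv ℝ φ (x - s • h) (-h)) s := by
    intro s
    refine (hasDerivAt_integral_of_dominated_loc_of_deriv_le (𝕜 := ℝ) (μ := vol Ω) (s := Set.univ)
      (F := fun s x => f x * φ (x - s • h)) (F' := fun s x => f x * fderiv ℝ φ (x - s • h) (-h))
      (bound := fun x => |f x| * (C1 * ‖h‖)) univ_mem ?_ ?_ ?_ ?_ ?_ ?_).2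
    · exact Eventually.of_forall fun s => Integrable.aestronglyMeasurable <|
        (integrable_mul_bounded hΩ f (φ.continuous.comp (hsh s)) fun x => hC0 _)
    · exact integrable_mul_bounded hΩ f (φ.continuous.comp (hsh s)) fun x => hC0 _
    · refine (Lp.aestronglyMeasurable f).mul (Continuous.aestronglyMeasurable ?_)
      exact (hfd.comp (hsh s)).clm_apply continuous_const
    · refine Eventually.of_forall fun x s _ => ?_
      rw [norm_mul, Real.norm_eq_abs]
      refine mul_le_mul_of_nonneg_left ?_ (abs_nonneg _)
      refine (ContinuousLinearMap.le_opNorm _ _).trans ?_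
      rw [norm_neg]
      exact mul_le_mul_of_nonneg_right (hC1 _) (norm_nonneg _)
    · exact ((Lp.memLp f).integrable (by norm_num)).abs.mul_const _
    · refine Eventually.of_forall fun x s _ => ?_
      have h1 : HasDerivAt (fun s : ℝ => x - s • h) (-h) s := by
        simpa using ((hasDerivAt_id s).smul_const h).const_sub x
      exact ((differentiable_testFunction φ _).hasFDerivAt.comp_hasDerivAt s h1).const_mul _
  have hbd : ∀ s ∈ Set.Ico (0 : ℝ) 1,
      ‖∫ x in (Ω : Set E3), f x * fderiv ℝ φ (x - s • h) (-h)‖ ≤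
        3 * (‖h‖ * B * ‖testL2 Ω φ‖) := by
    intro s hs
    have hv : ∀ x ∈ tsupport φ, x + s • h ∈ Ω := fun x hx => hh x hx s ⟨hs.1, hs.2.le⟩
    let ψ := shiftTest φ (s • h) hv
    have e1 : ∫ x in (Ω : Set E3), f x * fderiv ℝ φ (x - s • h) (-h) =
        ∑ k, h k * inner ℝ (D k) (testL2 Ω ψ) := by
      have e2 : ∀ k, h k * inner ℝ (D k) (testL2 Ω ψ) =
          ∫ x in (Ω : Set E3), (-h k) * inner ℝ (f x) (partialTest k ψ x) := by
        intro k
        rw [integral_const_mul, ← inner_testL2, hasWeakPartial_iff.1 (hD k)]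
        ring
      simp only [e2]
      rw [← integral_finsetSum]
      · refine integral_congr_ae (Eventually.of_forall fun x => ?_)
        simp only
        rw [← fderiv_shiftTest φ (s • h) hv, map_neg, fderiv_apply_eq_sum, mul_neg,
          Finset.mul_sum, ← Finset.sum_neg_distrib]
        refine Finset.sum_congr rfl fun k _ => ?_
        simp only [RCLike.inner_apply, conj_trivial]
        simp [ψ]
        ring
      · intro k _
        refine Integrable.const_mul ?_ _
        obtain ⟨C, hC⟩ := (partialTest k ψ).continuous.bounded_above_of_compact_support
          (partialTest k ψ).hasCompactSupport
        refine (integrable_mul_bounded hΩ f (partialTest k ψ).continuous hC).congr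
          (Eventually.of_forall fun x => ?_)
        simp [mul_comm]
    rw [e1]
    refine (norm_sum_le _ _).trans ?_
    have hk : ∀ k ∈ (Finset.univ : Finset (Fin 3)), ‖h k * inner ℝ (D k) (testL2 Ω ψ)‖ ≤
        ‖h‖ * B * ‖testL2 Ω φ‖ := by
      intro k _
      rw [norm_mul, mul_assoc]
      refine mul_le_mul (PiLp.norm_apply_le h k) ?_ (norm_nonneg _) (norm_nonneg _)
      refine (norm_inner_le_norm _ _).trans ?_
      rw [norm_testL2_shiftTest]
      exact mul_le_mul_of_nonneg_right (hB k) (norm_nonneg _)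
    refine (Finset.sum_le_sum hk).trans ?_
    simp
  have := norm_image_sub_le_of_norm_deriv_le_segment_01'
    (fun s _ => (hder s).hasDerivWithinAt) hbd
  simpa using this

/-- The integral of `f`, extended by zero outside `Ω`, over the ball of centre `h₀ + y` and
radius `r`. -/
def ballIntegral {Ω : Opens E3} (f : ScalL2 Ω) (h₀ : E3) (r : ℝ) (y : E3) : ℝ :=
  ∫ h in Metric.ball h₀ r, (Ω : Set E3).indicator f (h + y)

theorem integrable_indicator_add {Ω : Opens E3} (hΩ : Bornology.IsBounded (Ω : Set E3))
    (f : ScalL2 Ω) (h₀ : E3) (r : ℝ) :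
    Integrable (fun p : E3 × E3 => (Ω : Set E3).indicator f (p.1 + p.2))
      ((volume.restrict (Metric.ball h₀ r)).prod volume) := by
  have : IsFiniteMeasure (vol Ω) := ⟨by simpa using hΩ.measure_lt_top⟩
  have : IsFiniteMeasure (volume.restrict (Metric.ball h₀ r)) :=
    ⟨by rw [Measure.restrict_apply_univ]; exact measure_ball_lt_top⟩
  have h1 : Integrable ((Ω : Set E3).indicator f) volume :=
    (integrable_indicator_iff Ω.isOpen.measurableSet).2 ((Lp.memLp f).integrable (by norm_num))
  exact (measurePreserving_prod_add (volume.restrict (Metric.ball h₀ r))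
    volume).integrable_comp_of_integrable
    (h1.comp_snd (volume.restrict (Metric.ball h₀ r)))

/-- For fixed `y`, the ball integral is a bounded linear functional of `f`. -/
theorem ballIntegral_eq_inner {Ω : Opens E3} (f : ScalL2 Ω) (h₀ : E3) (r : ℝ) (y : E3)
    (hfin : vol Ω (Metric.ball (h₀ + y) r) ≠ ∞) :
    ballIntegral f h₀ r y =
      inner ℝ f (indicatorConstLp 2 (measurableSet_ball (x := h₀ + y) (ε := r)) hfin (1 : ℝ)) := by
  rw [real_inner_comm, L2.inner_indicatorConstLp_one, ballIntegral,
    Measure.restrict_restrict measurableSet_ball, ← setIntegral_indicator Ω.isOpen.measurableSet]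
  have hpre : Metric.ball h₀ r = (fun h => h + y) ⁻¹' Metric.ball (h₀ + y) r := by
    ext h; simp [Metric.mem_ball]
  rw [hpre]
  exact (measurePreserving_add_right volume y).setIntegral_preimage_emb
    (measurableEmbedding_addRight y) _ _

theorem abs_ballIntegral_le {Ω : Opens E3} (hΩ : Bornology.IsBounded (Ω : Set E3))
    (f : ScalL2 Ω) (h₀ : E3) (r : ℝ) (y : E3) :
    |ballIntegral f h₀ r y| ≤ ‖f‖ * (volume.real (Metric.ball (0 : E3) r)) ^ (1 / 2 : ℝ) := by
  have : IsFiniteMeasure (vol Ω) := ⟨by simpa using hΩ.measure_lt_top⟩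
  rw [ballIntegral_eq_inner f h₀ r y (measure_ne_top _ _)]
  refine (abs_real_inner_le_norm _ _).trans (mul_le_mul_of_nonneg_left ?_ (norm_nonneg _))
  rw [norm_indicatorConstLp (by norm_num) (by norm_num), norm_one, one_mul]
  refine Real.rpow_le_rpow measureReal_nonneg ?_ (by norm_num)
  rw [Measure.real, Measure.real, ← Measure.addHaar_ball_center volume (h₀ + y) r]
  exact ENNReal.toReal_mono measure_ball_lt_top.ne (Measure.restrict_apply_le _ _)

theorem integrable_ballIntegral {Ω : Opens E3} (hΩ : Bornology.IsBounded (Ω : Set E3))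
    (f : ScalL2 Ω) (h₀ : E3) (r : ℝ) : Integrable (ballIntegral f h₀ r) volume :=
  (integrable_indicator_add hΩ f h₀ r).integral_prod_right

theorem setIntegral_shift_eq {Ω : Opens E3} (f : ScalL2 Ω) (φ : E3 → ℝ) (h : E3) :
    ∫ x in (Ω : Set E3), f x * φ (x - h) = ∫ y, (Ω : Set E3).indicator f (h + y) * φ y := by
  rw [← integral_indicator Ω.isOpen.measurableSet, ← integral_add_left_eq_self _ h]
  refine integral_congr_ae (Eventually.of_forall fun y => ?_)
  simp only [Set.indicator_mul_left, add_sub_cancel_left]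

/-- Averaging over the translations in a ball contained in the ball of radius `t` about the origin:
the pairing of `f` with a test function exceeds that of its local averages by at most
`3 t B ‖φ‖`, all multiplied by the volume of the ball. -/
theorem measure_mul_integral_le {Ω : Opens E3} (hΩ : Bornology.IsBounded (Ω : Set E3))
    {f : ScalL2 Ω} {D : Fin 3 → ScalL2 Ω} (hD : ∀ k, HasWeakPartial Ω k f (D k)) {B : ℝ}
    (hB : ∀ k, ‖D k‖ ≤ B) (φ : 𝓓(Ω, ℝ)) {h₀ : E3} {r t : ℝ}
    (ht : Metric.ball h₀ r ⊆ Metric.ball 0 t)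
    (hh : ∀ h ∈ Metric.ball h₀ r, ∀ x ∈ tsupport φ, ∀ s ∈ Set.Icc (0 : ℝ) 1, x + s • h ∈ Ω) :
    volume.real (Metric.ball h₀ r) * (∫ x in (Ω : Set E3), f x * φ x) ≤
      volume.real (Metric.ball h₀ r) * (3 * (t * B * ‖testL2 Ω φ‖)) +
        ∫ y, ballIntegral f h₀ r y * φ y := by
  have hB0 : 0 ≤ B := (norm_nonneg _).trans (hB 0)
  have : IsFiniteMeasure (volume.restrict (Metric.ball h₀ r)) :=
    ⟨by rw [Measure.restrict_apply_univ]; exact measure_ball_lt_top⟩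
  obtain ⟨C, hC⟩ := φ.continuous.bounded_above_of_compact_support φ.hasCompactSupport
  have hint : Integrable (fun p : E3 × E3 => (Ω : Set E3).indicator f (p.1 + p.2) * φ p.2)
      ((volume.restrict (Metric.ball h₀ r)).prod volume) :=
    (integrable_indicator_add hΩ f h₀ r).mul_bdd (c := C)
      (φ.continuous.comp continuous_snd).aestronglyMeasurable (Eventually.of_forall fun p => hC _)
  have hQ : Integrable (fun h => ∫ x in (Ω : Set E3), f x * φ (x - h))
      (volume.restrict (Metric.ball h₀ r)) := by
    simp only [setIntegral_shift_eq]
    exact hint.integral_prod_left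
  have hswap : ∫ h in Metric.ball h₀ r, ∫ x in (Ω : Set E3), f x * φ (x - h) =
      ∫ y, ballIntegral f h₀ r y * φ y := by
    simp only [setIntegral_shift_eq]
    rw [integral_integral_swap hint]
    refine integral_congr_ae (Eventually.of_forall fun y => ?_)
    simp only [ballIntegral, integral_mul_const]
  rw [← hswap]
  have e1 : ∀ c : ℝ, volume.real (Metric.ball h₀ r) * c = ∫ _ in Metric.ball h₀ r, c := by
    intro c; simp
  rw [e1, e1, ← integral_add (integrable_const _) hQ]
  refine setIntegral_mono_on (integrable_const _) ((integrable_const _).add hQ)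
    measurableSet_ball fun h hh' => ?_
  have h1 := abs_integral_sub_shift_le hΩ hD hB φ (h := h) (hh h hh')
  have h2 : ‖h‖ ≤ t := (mem_ball_zero_iff.1 (ht hh')).le
  have h3 : ‖h‖ * B * ‖testL2 Ω φ‖ ≤ t * B * ‖testL2 Ω φ‖ := by gcongr
  have h4 := (abs_le.1 h1).1
  linarith

/-- The restriction of an `L²` function to a smaller open set. -/
def restrL2 {A Ω : Opens E3} (hA : A ≤ Ω) (f : ScalL2 Ω) : ScalL2 A :=
  ((Lp.memLp f).mono_measure (Measure.restrict_mono (by exact hA) le_rfl)).toLp f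

theorem memLp_ballIntegral {Ω A : Opens E3} (hΩ : Bornology.IsBounded (Ω : Set E3)) (hA : A ≤ Ω)
    (f : ScalL2 Ω) (h₀ : E3) (r : ℝ) : MemLp (ballIntegral f h₀ r) 2 (vol A) := by
  have hA' : (A : Set E3) ⊆ Ω := hA
  have : IsFiniteMeasure (vol A) := ⟨by simpa using (hΩ.subset hA').measure_lt_top⟩
  exact MemLp.of_bound (integrable_ballIntegral hΩ f h₀ r).aestronglyMeasurable.restrict _
    (Eventually.of_forall fun y => abs_ballIntegral_le hΩ f h₀ r y)

theorem coeFn_restrL2 {A Ω : Opens E3} (hA : A ≤ Ω) (f : ScalL2 Ω) :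
    restrL2 hA f =ᵐ[vol A] f := MemLp.coeFn_toLp _

/-- On `A`, the `L²` norm of `f` exceeds that of its averages over the translates of the ball of
centre `h₀` by at most a multiple of the size of the shifts. -/
theorem norm_restrL2_le {Ω A : Opens E3} (hΩ : Bornology.IsBounded (Ω : Set E3)) (hA : A ≤ Ω)
    {f : ScalL2 Ω} {D : Fin 3 → ScalL2 Ω} (hD : ∀ k, HasWeakPartial Ω k f (D k)) {B : ℝ}
    (hB : ∀ k, ‖D k‖ ≤ B) {h₀ : E3} {r t : ℝ} (hr : 0 < r)
    (ht : Metric.ball h₀ r ⊆ Metric.ball 0 t)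
    (hh : ∀ h ∈ Metric.ball h₀ r, ∀ x ∈ A, ∀ s ∈ Set.Icc (0 : ℝ) 1, x + s • h ∈ Ω) :
    ‖restrL2 hA f‖ ≤ 3 * (t * B) +
      (volume.real (Metric.ball h₀ r))⁻¹ * ‖(memLp_ballIntegral hΩ hA f h₀ r).toLp‖ := by
  have hB0 : 0 ≤ B := (norm_nonneg _).trans (hB 0)
  have ht0 : 0 ≤ t := by
    have : ‖h₀‖ < t := by simpa using ht (Metric.mem_ball_self hr)
    exact (norm_nonneg _).trans this.le
  have hm : 0 < volume.real (Metric.ball h₀ r) :=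
    ENNReal.toReal_pos (Metric.measure_ball_pos _ _ hr).ne' measure_ball_lt_top.ne
  refine norm_le_of_forall_inner_testL2_le (by positivity) fun φ => ?_
  let ψ : 𝓓(Ω, ℝ) := ⟨φ, smooth_testFunction φ, φ.hasCompactSupport, φ.tsupport_subset.trans hA⟩
  have hψ : (ψ : E3 → ℝ) = φ := rfl
  have hψn : ‖testL2 Ω ψ‖ = ‖testL2 A φ‖ := by rw [norm_testL2, norm_testL2, hψ]
  have h0 : ∀ x, x ∉ (A : Set E3) → φ x = 0 := fun x hx =>
    image_eq_zero_of_notMem_tsupport (fun h' => hx (φ.tsupport_subset h'))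
  have h1 := measure_mul_integral_le hΩ hD hB ψ ht
    fun h hh' x hx => hh h hh' x (φ.tsupport_subset hx)
  have e1 : inner ℝ (restrL2 hA f) (testL2 A φ) = ∫ x in (Ω : Set E3), f x * ψ x := by
    rw [inner_testL2]
    have : ∫ x in (A : Set E3), inner ℝ (restrL2 hA f x) (φ x) =
        ∫ x in (A : Set E3), f x * φ x := by
      refine integral_congr_ae ?_
      filter_upwards [coeFn_restrL2 hA f] with x hx
      simp [hx, mul_comm]
    rw [this, hψ]
    symm
    refine setIntegral_eq_of_subset_of_forall_sdiff_eq_zero Ω.isOpen.measurableSet hA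
      fun x hx => ?_
    rw [h0 x hx.2, mul_zero]
  have e2 : ∫ y, ballIntegral f h₀ r y * ψ y =
      inner ℝ (memLp_ballIntegral hΩ hA f h₀ r).toLp (testL2 A φ) := by
    rw [inner_testL2, hψ]
    have : ∫ y, ballIntegral f h₀ r y * φ y = ∫ y in (A : Set E3), ballIntegral f h₀ r y * φ y := by
      rw [setIntegral_eq_integral_of_forall_compl_eq_zero]
      intro x hx
      rw [h0 x hx, mul_zero]
    rw [this]
    refine integral_congr_ae ?_
    filter_upwards [(memLp_ballIntegral hΩ hA f h₀ r).coeFn_toLp] with x hx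
    simp [hx, mul_comm]
  rw [e2, hψn, ← e1] at h1
  have h2 := h1.trans (add_le_add_right (real_inner_le_norm _ _) _)
  have h3 : inner ℝ (restrL2 hA f) (testL2 A φ) = (volume.real (Metric.ball h₀ r))⁻¹ *
      (volume.real (Metric.ball h₀ r) * inner ℝ (restrL2 hA f) (testL2 A φ)) := by
    field_simp
  rw [h3]
  refine (mul_le_mul_of_nonneg_left h2 (inv_nonneg.2 hm.le)).trans (le_of_eq ?_)
  field_simp

/-- Weak convergence makes the local averages converge strongly. -/
theorem tendsto_norm_ballIntegral {Ω A : Opens E3} (hΩ : Bornology.IsBounded (Ω : Set E3))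
    (hA : A ≤ Ω) {f : ℕ → ScalL2 Ω} (hf : WeakTendsto f 0) {B : ℝ} (hB : ∀ n, ‖f n‖ ≤ B)
    (h₀ : E3) (r : ℝ) :
    Tendsto (fun n => ‖(memLp_ballIntegral hΩ hA (f n) h₀ r).toLp‖) atTop (𝓝 0) := by
  have hA' : (A : Set E3) ⊆ Ω := hA
  have : IsFiniteMeasure (vol A) := ⟨by simpa using (hΩ.subset hA').measure_lt_top⟩
  have : IsFiniteMeasure (vol Ω) := ⟨by simpa using hΩ.measure_lt_top⟩
  set c := (volume.real (Metric.ball (0 : E3) r)) ^ (1 / 2 : ℝ) with hc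
  have hc0 : 0 ≤ c := Real.rpow_nonneg measureReal_nonneg _
  have hsq : ∀ n, ‖(memLp_ballIntegral hΩ hA (f n) h₀ r).toLp‖ ^ 2 =
      ∫ y in (A : Set E3), ballIntegral (f n) h₀ r y ^ 2 := by
    intro n
    rw [← real_inner_self_eq_norm_sq, L2.inner_def]
    refine integral_congr_ae ?_
    filter_upwards [(memLp_ballIntegral hΩ hA (f n) h₀ r).coeFn_toLp] with x hx
    simp [hx]
  have hlim : Tendsto (fun n => ∫ y in (A : Set E3), ballIntegral (f n) h₀ r y ^ 2) atTop
      (𝓝 (∫ _ in (A : Set E3), (0 : ℝ))) := by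
    refine tendsto_integral_of_dominated_convergence (fun _ => (B * c) ^ 2) (fun n => ?_)
      (integrable_const _) (fun n => Eventually.of_forall fun y => ?_)
      (Eventually.of_forall fun y => ?_)
    · exact (memLp_ballIntegral hΩ hA (f n) h₀ r).aestronglyMeasurable.pow 2
    · rw [Real.norm_eq_abs, abs_pow]
      refine pow_le_pow_left₀ (abs_nonneg _) ?_ 2
      exact (abs_ballIntegral_le hΩ (f n) h₀ r y).trans (mul_le_mul_of_nonneg_right (hB n) hc0)
    · have h1 := hf (indicatorConstLp 2 (measurableSet_ball (x := h₀ + y) (ε := r))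
        (measure_ne_top (vol Ω) _) (1 : ℝ))
      rw [inner_zero_left] at h1
      simp only [← ballIntegral_eq_inner] at h1
      simpa using h1.pow 2
  simp only [← hsq, integral_zero] at hlim
  have := hlim.sqrt
  simpa using this

/-- The segments `x + [0, 1] h` issuing from points `x ∈ A` stay in `Ω` for all `h` in a ball,
which can be taken arbitrarily close to the origin. -/
def HasInnerShifts (Ω A : Opens E3) : Prop :=
  ∀ t > (0 : ℝ), ∃ (h₀ : E3) (r : ℝ), 0 < r ∧ Metric.ball h₀ r ⊆ Metric.ball 0 t ∧
    ∀ h ∈ Metric.ball h₀ r, ∀ x ∈ A, ∀ s ∈ Set.Icc (0 : ℝ) 1, x + s • h ∈ Ω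

/-- Rellich compactness on a subset whose points can be shifted inside `Ω`. -/
theorem tendsto_norm_restrL2 {Ω A : Opens E3} (hΩ : Bornology.IsBounded (Ω : Set E3))
    (hA : A ≤ Ω) (hshift : HasInnerShifts Ω A) {f : ℕ → ScalL2 Ω} (hf : WeakTendsto f 0)
    {D : ℕ → Fin 3 → ScalL2 Ω} (hD : ∀ n k, HasWeakPartial Ω k (f n) (D n k)) {B : ℝ}
    (hfB : ∀ n, ‖f n‖ ≤ B) (hB : ∀ n k, ‖D n k‖ ≤ B) :
    Tendsto (fun n => ‖restrL2 hA (f n)‖) atTop (𝓝 0) := by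
  have hB0 : 0 ≤ B := (norm_nonneg _).trans (hfB 0)
  rw [Metric.tendsto_atTop]
  intro η hη
  obtain ⟨h₀, r, hr, ht, hh⟩ := hshift (η / (6 * (B + 1))) (by positivity)
  have hlim := (tendsto_norm_ballIntegral hΩ hA hf hfB h₀ r).const_mul
    (volume.real (Metric.ball h₀ r))⁻¹
  rw [mul_zero] at hlim
  obtain ⟨N, hN⟩ := Metric.tendsto_atTop.1 hlim (η / 2) (by positivity)
  refine ⟨N, fun n hn => ?_⟩
  have h1 := norm_restrL2_le hΩ hA (hD n) (hB n) hr ht hh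
  have h2 := hN n hn
  rw [Real.dist_eq, sub_zero] at h2
  have h3 := (abs_lt.1 h2).2
  have h4 : 3 * (η / (6 * (B + 1)) * B) ≤ η / 2 := by
    have : η / (6 * (B + 1)) * B ≤ η / (6 * (B + 1)) * (B + 1) := by gcongr; linarith
    have e : η / (6 * (B + 1)) * (B + 1) = η / 6 := by field_simp
    linarith
  rw [Real.dist_eq, sub_zero, abs_of_nonneg (norm_nonneg _)]
  linarith

theorem enorm_restrL2_rpow {Ω A : Opens E3} (hA : A ≤ Ω) (f : ScalL2 Ω) :
    ‖restrL2 hA f‖ₑ ^ (2 : ℝ) = ∫⁻ x in (A : Set E3), ‖f x‖ₑ ^ (2 : ℝ) := by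
  rw [Lp.enorm_def, eLpNorm_congr_ae (coeFn_restrL2 hA f)]
  exact eLpNorm_nnreal_pow_eq_lintegral (p := 2) (by norm_num)

theorem hasInnerShifts_of_mem {Ω : Opens E3} {p : E3} (hp : p ∈ Ω) :
    ∃ (s : Set E3) (hs : IsOpen s), p ∈ s ∧ HasInnerShifts Ω (⟨s, hs⟩ ⊓ Ω) := by
  obtain ⟨r, hr, hball⟩ := Metric.isOpen_iff.1 Ω.isOpen p hp
  refine ⟨Metric.ball p (r / 2), Metric.isOpen_ball, Metric.mem_ball_self (by positivity),
    fun t ht => ⟨0, min t (r / 2), by positivity, Metric.ball_subset_ball (min_le_left _ _),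
      fun h hh x hx s hs => hball ?_⟩⟩
  have h1 : ‖h‖ < r / 2 := (mem_ball_zero_iff.1 hh).trans_le (min_le_right _ _)
  have h2 : ‖x - p‖ < r / 2 := mem_ball_iff_norm.1 hx.1
  rw [mem_ball_iff_norm, add_sub_right_comm]
  have h3 : ‖s • h‖ ≤ ‖h‖ := by
    rw [norm_smul, Real.norm_of_nonneg hs.1]
    exact mul_le_of_le_one_left (norm_nonneg _) hs.2
  linarith [norm_add_le (x - p) (s • h)]

/-- Above a Lipschitz graph, every point can be moved along a cone of directions. -/
theorem hasInnerShifts_of_mem_frontier {Ω : Opens E3} (hΩ : IsBoundedLipschitzDomain Ω) {p : E3}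
    (hp : p ∈ frontier (Ω : Set E3)) :
    ∃ (s : Set E3) (hs : IsOpen s), p ∈ s ∧ HasInnerShifts Ω (⟨s, hs⟩ ⊓ Ω) := by
  obtain ⟨r, b, K, g, hr, hg, hgraph⟩ := hΩ.locally_graph p hp
  refine ⟨Metric.ball p (r / 2), Metric.isOpen_ball, Metric.mem_ball_self (by positivity),
    fun t ht => ?_⟩
  -- the ball around `τ b₂` of radius `δ` lies in the cone of directions pointing above the graph
  set τ := min t (r / 2) / 2 with hτ
  have hτ0 : 0 < τ := by positivity
  set δ := τ / (K + 2) with hδ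
  have hK : (0 : ℝ) ≤ K := K.2
  have hδ0 : 0 < δ := by positivity
  have hδτ : (K + 2) * δ = τ := by rw [hδ]; field_simp
  have hnorm : ∀ h ∈ Metric.ball (τ • b 2) δ, ‖h‖ < 2 * τ := by
    intro h hh
    have h1 : ‖h - τ • b 2‖ < δ := mem_ball_iff_norm.1 hh
    have h2 : ‖τ • b 2‖ = τ := by
      rw [norm_smul, b.norm_eq_one, mul_one, Real.norm_of_nonneg hτ0.le]
    have h3 := norm_add_le (h - τ • b 2) (τ • b 2)
    rw [sub_add_cancel] at h3
    nlinarith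
  have hτt : 2 * τ ≤ t := by rw [hτ]; linarith [min_le_left t (r / 2)]
  have hτr : 2 * τ ≤ r / 2 := by rw [hτ]; linarith [min_le_right t (r / 2)]
  refine ⟨τ • b 2, δ, hδ0, fun h hh => mem_ball_zero_iff.2 ((hnorm h hh).trans_le hτt),
    fun h hh x hx s hs => ?_⟩
  have hxp : ‖x - p‖ < r / 2 := mem_ball_iff_norm.1 hx.1
  have hsh : ‖s • h‖ ≤ ‖h‖ := by
    rw [norm_smul, Real.norm_of_nonneg hs.1]
    exact mul_le_of_le_one_left (norm_nonneg _) hs.2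
  have hmem : x + s • h ∈ Metric.ball p r := by
    rw [mem_ball_iff_norm, add_sub_right_comm]
    linarith [norm_add_le (x - p) (s • h), hnorm h hh]
  rw [hgraph _ hmem]
  have hxg := (hgraph x (mem_ball_iff_norm.2 (hxp.trans (by linarith)))).1 hx.2
  have hdiff : ‖h - τ • b 2‖ ≤ δ := (mem_ball_iff_norm.1 hh).le
  have hcoord : ∀ i, |inner ℝ (b i) (h - τ • b 2)| ≤ δ := fun i => by
    refine (abs_real_inner_le_norm _ _).trans ?_
    rwa [b.norm_eq_one, one_mul]
  have h20 : inner ℝ (b 0) (b 2) = (0 : ℝ) := b.orthonormal.2 (by decide)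
  have h21 : inner ℝ (b 1) (b 2) = (0 : ℝ) := b.orthonormal.2 (by decide)
  have h22 : inner ℝ (b 2) (b 2) = (1 : ℝ) := by
    rw [real_inner_self_eq_norm_sq, b.norm_eq_one, one_pow]
  have c0 : |inner ℝ (b 0) h| ≤ δ := by
    have := hcoord 0
    rwa [inner_sub_right, inner_smul_right, h20, mul_zero, sub_zero] at this
  have c1 : |inner ℝ (b 1) h| ≤ δ := by
    have := hcoord 1
    rwa [inner_sub_right, inner_smul_right, h21, mul_zero, sub_zero] at this
  have c2 : τ - δ ≤ inner ℝ (b 2) h := by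
    have := (abs_le.1 (hcoord 2)).1
    rw [inner_sub_right, inner_smul_right, h22, mul_one] at this
    linarith
  have hlip := hg.dist_le_mul (inner ℝ (b 0) (x + s • h), inner ℝ (b 1) (x + s • h))
    (inner ℝ (b 0) x, inner ℝ (b 1) x)
  have hdist : dist (inner ℝ (b 0) (x + s • h), inner ℝ (b 1) (x + s • h))
      (inner ℝ (b 0) x, inner ℝ (b 1) x) ≤ s * δ := by
    rw [Prod.dist_eq, max_le_iff]
    simp only [Real.dist_eq, inner_add_right, inner_smul_right, add_sub_cancel_left, abs_mul,
      abs_of_nonneg hs.1]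
    exact ⟨mul_le_mul_of_nonneg_left c0 hs.1, mul_le_mul_of_nonneg_left c1 hs.1⟩
  have h5 := (le_abs_self _).trans (hlip.trans (mul_le_mul_of_nonneg_left hdist hK))
  have h6 : inner ℝ (b 2) (x + s • h) = inner ℝ (b 2) x + s * inner ℝ (b 2) h := by
    rw [inner_add_right, inner_smul_right]
  have h7 : s * (K * δ) ≤ s * inner ℝ (b 2) h :=
    mul_le_mul_of_nonneg_left (by nlinarith) hs.1
  rw [h6]
  nlinarith

/-- **Rellich's theorem**: on a bounded Lipschitz domain, a weakly null sequence in `L²` with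
bounded weak gradients converges strongly. -/
theorem tendsto_norm_of_weakTendsto {Ω : Opens E3} (hΩ : IsBoundedLipschitzDomain Ω)
    {f : ℕ → ScalL2 Ω} (hf : WeakTendsto f 0)
    {D : ℕ → Fin 3 → ScalL2 Ω} (hD : ∀ n k, HasWeakPartial Ω k (f n) (D n k)) {B : ℝ}
    (hfB : ∀ n, ‖f n‖ ≤ B) (hB : ∀ n k, ‖D n k‖ ≤ B) :
    Tendsto (fun n => ‖f n‖) atTop (𝓝 0) := by
  have hK : IsCompact (closure (Ω : Set E3)) := hΩ.isBounded.isCompact_closure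
  have key : Tendsto (fun n => ∫⁻ x in closure (Ω : Set E3) ∩ Ω, ‖f n x‖ₑ ^ (2 : ℝ)) atTop
      (𝓝 0) := by
    refine hK.induction_on
      (p := fun s => Tendsto (fun n => ∫⁻ x in s ∩ Ω, ‖f n x‖ₑ ^ (2 : ℝ)) atTop (𝓝 0))
      ?_ ?_ ?_ ?_
    · simp
    · intro s t hst ht
      exact tendsto_of_tendsto_of_tendsto_of_le_of_le tendsto_const_nhds ht (fun _ => zero_le)
        fun n => lintegral_mono_set (Set.inter_subset_inter_left _ hst)
    · intro s t hs ht
      have hst := hs.add ht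
      rw [add_zero] at hst
      refine tendsto_of_tendsto_of_tendsto_of_le_of_le tendsto_const_nhds hst (fun _ => zero_le)
        fun n => ?_
      rw [Set.union_inter_distrib_right]
      exact lintegral_union_le _ _ _
    · intro p hp
      obtain ⟨s, hs, hps, hsh⟩ :
          ∃ (s : Set E3) (hs : IsOpen s), p ∈ s ∧ HasInnerShifts Ω (⟨s, hs⟩ ⊓ Ω) := by
        by_cases hpΩ : p ∈ Ω
        · exact hasInnerShifts_of_mem hpΩ
        · refine hasInnerShifts_of_mem_frontier hΩ ⟨hp, ?_⟩
          rwa [Ω.isOpen.interior_eq]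
      refine ⟨s, mem_nhdsWithin_of_mem_nhds (hs.mem_nhds hps), ?_⟩
      have h1 := tendsto_norm_restrL2 hΩ.isBounded (inf_le_right : (⟨s, hs⟩ ⊓ Ω : Opens E3) ≤ Ω)
        hsh hf hD hfB hB
      have h2 := (tendsto_zero_iff_enorm_tendsto_zero.1
        (tendsto_zero_iff_norm_tendsto_zero.2 h1)).ennrpow_const 2
      simp only [enorm_restrL2_rpow] at h2
      simpa using h2
  have h3 : ∀ n, ‖f n‖ₑ =
      (∫⁻ x in closure (Ω : Set E3) ∩ Ω, ‖f n x‖ₑ ^ (2 : ℝ)) ^ (1 / 2 : ℝ) := by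
    intro n
    rw [Set.inter_eq_self_of_subset_right subset_closure, Lp.enorm_def]
    exact eLpNorm_nnreal_eq_lintegral (p := 2) (by norm_num)
  have h4 := key.ennrpow_const (1 / 2)
  simp only [← h3] at h4
  refine tendsto_zero_iff_norm_tendsto_zero.1 (tendsto_zero_iff_enorm_tendsto_zero.2 ?_)
  simpa using h4

/-! ### Compactness of the embedding of `X_N^ε(Ω)` in `L²(Ω)³` -/

instance {F : Type} [NormedAddCommGroup F] [InnerProductSpace ℝ F] [SeparableSpace F]
    (Ω : Opens E3) : SecondCountableTopology (Lp F 2 (vol Ω)) :=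
  have : Fact ((2 : ℝ≥0∞) ≠ ∞) := ⟨by norm_num⟩
  inferInstance

/-- The `i`-th component of a vector field. -/
def compL2 {Ω : Opens E3} (i : Fin 3) : VecL2 Ω →L[ℝ] ScalL2 Ω :=
  (EuclideanSpace.proj (𝕜 := ℝ) i : E3 →L[ℝ] ℝ).compLpL 2 (vol Ω)

theorem coeFn_compL2 {Ω : Opens E3} (i : Fin 3) (u : VecL2 Ω) :
    compL2 i u =ᵐ[vol Ω] fun x => u x i :=
  (EuclideanSpace.proj (𝕜 := ℝ) i : E3 →L[ℝ] ℝ).coeFn_compLpL u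

theorem norm_sq_eq_sum_compL2 {Ω : Opens E3} (u : VecL2 Ω) :
    ‖u‖ ^ 2 = ∑ i, ‖compL2 i u‖ ^ 2 := by
  have h : ∀ i, ‖compL2 i u‖ ^ 2 = ∫ x in (Ω : Set E3), inner ℝ (compL2 i u x) (compL2 i u x) := by
    intro i
    rw [← real_inner_self_eq_norm_sq, L2.inner_def]
  simp only [h]
  rw [← integral_finsetSum _ fun i _ => L2.integrable_inner (compL2 i u) (compL2 i u),
    ← real_inner_self_eq_norm_sq, L2.inner_def]
  refine integral_congr_ae ?_
  filter_upwards [coeFn_compL2 0 u, coeFn_compL2 1 u, coeFn_compL2 2 u] with x h0 h1 h2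
  simp only [Fin.sum_univ_three, h0, h1, h2, PiLp.inner_apply]

theorem hasWeakPartial_congr {Ω : Opens E3} {k : Fin 3} {f f' g : E3 → ℝ}
    (hf : f =ᵐ[vol Ω] f') (h : HasWeakPartial Ω k f g) : HasWeakPartial Ω k f' g := by
  intro φ
  rw [← h φ]
  refine integral_congr_ae ?_
  filter_upwards [hf] with x hx
  rw [hx]

theorem hasWeakPartial_testL2 {Ω : Opens E3} (k : Fin 3) (ψ : 𝓓(Ω, ℝ)) :
    HasWeakPartial Ω k (testL2 Ω ψ) (testL2 Ω (partialTest k ψ)) := by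
  have h : ∀ φ η : 𝓓(Ω, ℝ), inner ℝ (testL2 Ω φ) (testL2 Ω η) =
      ∫ x in (Ω : Set E3), φ x * η x := by
    intro φ η
    rw [inner_testL2]
    refine integral_congr_ae ?_
    filter_upwards [coeFn_testL2 φ] with x hx
    simp [hx, mul_comm]
  rw [hasWeakPartial_iff]
  intro φ
  rw [h, h, integral_mul_partialTest]

theorem compL2_testL2_gradTest {Ω : Opens E3} (k : Fin 3) (ψ : 𝓓(Ω, ℝ)) :
    compL2 k (testL2 Ω (gradTest ψ)) = testL2 Ω (partialTest k ψ) := by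
  refine Lp.ext ?_
  filter_upwards [coeFn_compL2 k (testL2 Ω (gradTest ψ)), coeFn_testL2 (gradTest ψ),
    coeFn_testL2 (partialTest k ψ)] with x h1 h2 h3
  rw [h1, h2, h3, gradTest_apply_apply]

theorem norm_compL2_le {Ω : Opens E3} (i : Fin 3) (u : VecL2 Ω) : ‖compL2 i u‖ ≤ ‖u‖ := by
  refine le_of_sq_le_sq ?_ (norm_nonneg _)
  rw [norm_sq_eq_sum_compL2]
  exact Finset.single_le_sum (f := fun i => ‖compL2 i u‖ ^ 2) (fun _ _ => sq_nonneg _)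
    (Finset.mem_univ i)

/-- The closure in `L²(Ω)³` of the gradients of test functions, that is, `∇H¹₀(Ω)` for bounded
`Ω`. -/
def gradSpace (Ω : Opens E3) : Submodule ℝ (VecL2 Ω) :=
  (LinearMap.range (testL2 Ω ∘ₗ (gradTest (Ω := Ω)).toLinearMap)).topologicalClosure

instance (Ω : Opens E3) : CompleteSpace (gradSpace Ω) :=
  (Submodule.isClosed_topologicalClosure _).completeSpace_coe

theorem testL2_gradTest_mem {Ω : Opens E3} (ψ : 𝓓(Ω, ℝ)) :
    testL2 Ω (gradTest ψ) ∈ gradSpace Ω :=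
  Submodule.le_topologicalClosure _ ⟨ψ, rfl⟩

theorem mem_curlGraph_of_mem_gradSpace {Ω : Opens E3} {g : VecL2 Ω} (hg : g ∈ gradSpace Ω) :
    WithLp.toLp 2 (g, (0 : VecL2 Ω)) ∈ curlGraph Ω := by
  have hcl : IsClosed {g : VecL2 Ω | WithLp.toLp 2 (g, (0 : VecL2 Ω)) ∈ curlGraph Ω} :=
    (Submodule.isClosed_topologicalClosure _).preimage
      ((WithLp.prod_continuous_toLp 2 _ _).comp (by fun_prop))
  refine closure_minimal ?_ hcl hg
  rintro _ ⟨ψ, rfl⟩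
  have := testL2_mem_curlGraph (gradTest ψ)
  rwa [curlTest_gradTest, map_zero] at this

/-- A weakly null sequence bounded in `H₀(curl, Ω)` and orthogonal to gradients converges strongly:
its terms are divergence free, so the Gaffney inequality for the permittivity `α I` bounds their
weak derivatives. -/
theorem tendsto_norm_of_orthogonal_gradSpace {Ω : Opens E3} {α β γ : ℝ} (hα : 0 < α)
    (hαβ : α < β) (hγ : 0 < γ) (hΩ : IsGaffneyDomain Ω α β γ) {w c : ℕ → VecL2 Ω}
    (hw : ∀ n, WithLp.toLp 2 (w n, c n) ∈ curlGraph Ω) (horth : ∀ n, w n ∈ (gradSpace Ω)ᗮ)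
    {B : ℝ} (hwB : ∀ n, ‖w n‖ ≤ B) (hcB : ∀ n, ‖c n‖ ≤ B) (hlim : WeakTendsto w 0) :
    Tendsto (fun n => ‖w n‖) atTop (𝓝 0) := by
  obtain ⟨hLip, C, hC, hGaff⟩ := hΩ
  have hadm := admissibleBdd_const Ω hαβ.le hγ.le
  have hb := hadm.1.memLp
  have hmdot : ∀ ξ η : E3, mdot (α • 1) ξ η = α * inner ℝ ξ η := by
    intro ξ η
    rw [mdot_eq_inner, matCLM, map_smul, map_one]
    simp [inner_smul_left]
  have hinner : ∀ u v : VecL2 Ω, innerEps Ω (fun _ => α • 1) u v = α * inner ℝ u v := by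
    intro u v
    rw [innerEps, L2.inner_def, ← integral_const_mul]
    simp only [hmdot]
  have hdiv : ∀ n, HasWeakDiv Ω (fun _ => α • 1) (w n) 0 := by
    intro n
    rw [hasWeakDiv_iff hb]
    intro φ
    rw [← innerEps_eq, hinner, inner_zero_left, neg_zero, real_inner_comm,
      (Submodule.mem_orthogonal _ _).1 (horth n) _ (testL2_gradTest_mem φ), mul_zero]
  have hXN : ∀ n, w n ∈ XN Ω (fun _ => α • 1) := fun n =>
    ⟨mem_HCurlZero_of_mem_curlGraph (hw n), ⟨0, hdiv n⟩⟩
  choose D hD hDle using fun n => hGaff _ hadm (w n) (hXN n)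
  have hB0 : 0 ≤ B := (norm_nonneg _).trans (hwB 0)
  set B' := max B (C * Real.sqrt (α * B ^ 2 + B ^ 2)) with hB'
  have hnorm : ∀ n, normXN Ω (fun _ => α • 1) (w n) ≤ Real.sqrt (α * B ^ 2 + B ^ 2) := by
    intro n
    rw [normXN, hinner, divEps_eq hb (hdiv n), curl_eq (hasWeakCurl_of_mem_curlGraph (hw n)),
      real_inner_self_eq_norm_sq]
    refine Real.sqrt_le_sqrt ?_
    have h1 := pow_le_pow_left₀ (norm_nonneg _) (hwB n) 2
    have h2 := pow_le_pow_left₀ (norm_nonneg _) (hcB n) 2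
    rw [norm_zero]
    nlinarith
  have hDB : ∀ n i k, ‖D n i k‖ ≤ B' := by
    intro n i k
    refine le_trans ?_ (((hDle n).trans (mul_le_mul_of_nonneg_left (hnorm n) hC.le)).trans
      (le_max_right _ _))
    refine Real.le_sqrt_of_sq_le ?_
    have h1 : ‖D n i k‖ ^ 2 ≤ ∑ k, ‖D n i k‖ ^ 2 :=
      Finset.single_le_sum (f := fun k => ‖D n i k‖ ^ 2) (fun _ _ => sq_nonneg _)
        (Finset.mem_univ k)
    have h2 : ∑ k, ‖D n i k‖ ^ 2 ≤ ∑ i, ∑ k, ‖D n i k‖ ^ 2 :=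
      Finset.single_le_sum (f := fun i => ∑ k, ‖D n i k‖ ^ 2)
        (fun _ _ => Finset.sum_nonneg fun _ _ => sq_nonneg _) (Finset.mem_univ i)
    linarith [sq_nonneg ‖w n‖]
  have hcomp : ∀ i, Tendsto (fun n => ‖compL2 i (w n)‖) atTop (𝓝 0) := by
    intro i
    have hl := hlim.map (compL2 i)
    rw [map_zero] at hl
    exact tendsto_norm_of_weakTendsto hLip hl (D := fun n => D n i)
      (fun n k => hasWeakPartial_congr (coeFn_compL2 i (w n)).symm (hD n i k))
      (fun n => ((norm_compL2_le i _).trans (hwB n)).trans (le_max_left _ _))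
      (fun n k => hDB n i k)
  have hsum : Tendsto (fun n => ∑ i, ‖compL2 i (w n)‖ ^ 2) atTop (𝓝 (∑ _i : Fin 3, (0 : ℝ) ^ 2)) :=
    tendsto_finsetSum _ fun i _ => (hcomp i).pow 2
  simp only [← norm_sq_eq_sum_compL2] at hsum
  have := hsum.sqrt
  simpa using this

/-- Test functions whose gradients converge weakly to zero have a strongly convergent
subsequence. -/
theorem exists_subseq_tendsto_testL2 {Ω : Opens E3} (hΩ : IsBoundedLipschitzDomain Ω)
    {ψ : ℕ → 𝓓(Ω, ℝ)} {B : ℝ} (hB : ∀ n, ‖testL2 Ω (gradTest (ψ n))‖ ≤ B)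
    (hlim : WeakTendsto (fun n => testL2 Ω (gradTest (ψ n))) 0) :
    ∃ p, ∃ s : ℕ → ℕ, StrictMono s ∧ Tendsto (fun n => testL2 Ω (ψ (s n))) atTop (𝓝 p) := by
  obtain ⟨C, hC, hP⟩ := exists_norm_testL2_le_gradTest hΩ.isBounded
  have hψB : ∀ n, ‖testL2 Ω (ψ n)‖ ≤ C * B := fun n =>
    (hP _).trans (mul_le_mul_of_nonneg_left (hB n) hC)
  obtain ⟨p, s, hs, hp⟩ := exists_subseq_weakTendsto hψB
  refine ⟨p, s, hs, ?_⟩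
  have hgrad : ∀ k, WeakTendsto (fun n => testL2 Ω (partialTest k (ψ (s n)))) 0 := by
    intro k
    have := (hlim.comp hs).map (compL2 k)
    simpa only [map_zero, Function.comp_apply, compL2_testL2_gradTest] using this
  -- the weak limit has zero gradient
  have hpk : ∀ k, HasWeakPartial Ω k p (0 : ScalL2 Ω) := by
    intro k
    rw [hasWeakPartial_iff]
    intro φ
    refine tendsto_nhds_unique (hp (testL2 Ω (partialTest k φ))) ?_
    have h1 := (hgrad k (testL2 Ω φ)).neg
    refine h1.congr fun n => ?_
    exact (hasWeakPartial_iff.1 (hasWeakPartial_testL2 k (ψ (s n))) φ).symm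
  have hsub := hp.sub_const p
  rw [sub_self] at hsub
  have := tendsto_norm_of_weakTendsto hΩ hsub
    (D := fun n k => testL2 Ω (partialTest k (ψ (s n)))) (fun n k => ?_)
    (B := max (C * B + ‖p‖) B)
    (fun n => (norm_sub_le _ _).trans ((add_le_add_left (hψB _) _).trans (le_max_left _ _)))
    (fun n k => ?_)
  · rw [tendsto_iff_norm_sub_tendsto_zero]
    exact this
  · rw [hasWeakPartial_iff]
    intro φ
    have h1 := hasWeakPartial_iff.1 (hasWeakPartial_testL2 k (ψ (s n))) φ
    have h2 := hasWeakPartial_iff.1 (hpk k) φ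
    rw [inner_zero_left, neg_zero] at h2
    simp only [Function.comp_apply]
    rw [inner_sub_left, h1, h2, sub_zero]
  · rw [← compL2_testL2_gradTest]
    exact ((norm_compL2_le k _).trans (hB _)).trans (le_max_right _ _)

theorem exists_gradTest_norm_sub_lt {Ω : Opens E3} {g : VecL2 Ω} (hg : g ∈ gradSpace Ω) {δ : ℝ}
    (hδ : 0 < δ) : ∃ ψ : 𝓓(Ω, ℝ), ‖g - testL2 Ω (gradTest ψ)‖ < δ := by
  obtain ⟨_, ⟨ψ, rfl⟩, h⟩ := Metric.mem_closure_iff.1 hg δ hδ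
  exact ⟨ψ, by rwa [dist_eq_norm] at h⟩

/-- **Weber's compactness theorem**: a weakly null sequence in `X_N^ε(Ω)` with bounded curls and
weakly null divergences has a strongly null subsequence. -/
theorem exists_subseq_tendsto_zero {Ω : Opens E3} {α β γ : ℝ} (hα : 0 < α)
    (hαβ : α < β) (hγ : 0 < γ) (hΩ : IsGaffneyDomain Ω α β γ)
    {ε : E3 → Matrix (Fin 3) (Fin 3) ℝ} (hε : Admissible Ω ε) {v c : ℕ → VecL2 Ω}
    {d : ℕ → ScalL2 Ω} (hv : ∀ n, WithLp.toLp 2 (v n, c n) ∈ curlGraph Ω)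
    (hd : ∀ n, HasWeakDiv Ω ε (v n) (d n)) {B : ℝ} (hvB : ∀ n, ‖v n‖ ≤ B)
    (hcB : ∀ n, ‖c n‖ ≤ B) (hdB : ∀ n, ‖d n‖ ≤ B) (hv0 : WeakTendsto v 0)
    (hd0 : WeakTendsto d 0) :
    ∃ s : ℕ → ℕ, StrictMono s ∧ Tendsto (fun n => v (s n)) atTop (𝓝 0) := by
  obtain ⟨κ, hκ, hcoer⟩ := hε.2
  have hb := hε.1.memLp
  set E := epsOp hb with hE
  set P := (gradSpace Ω).starProjection with hPdef
  have hPB : ∀ n, ‖P (v n)‖ ≤ B := fun n =>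
    ((gradSpace Ω).norm_starProjection_apply_le _).trans (hvB n)
  have hPmem : ∀ n, P (v n) ∈ gradSpace Ω := fun n => Submodule.starProjection_apply_mem _ _
  have hP0 : WeakTendsto (fun n => P (v n)) 0 := by simpa using hv0.map P
  have hw : Tendsto (fun n => ‖v n - P (v n)‖) atTop (𝓝 0) := by
    refine tendsto_norm_of_orthogonal_gradSpace hα hαβ hγ hΩ (c := c) (B := B + B) (fun n => ?_)
      (fun n => Submodule.sub_starProjection_mem_orthogonal _) (fun n => ?_) (fun n => ?_) ?_
    · have := (curlGraph Ω).sub_mem (hv n) (mem_curlGraph_of_mem_gradSpace (hPmem n))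
      rw [← WithLp.toLp_sub, Prod.mk_sub_mk, sub_zero] at this
      exact this
    · exact (norm_sub_le _ _).trans (add_le_add (hvB n) (hPB n))
    · linarith [hcB n, (norm_nonneg _).trans (hcB n)]
    · simpa using hv0.sub hP0
  choose ψ hψ using fun n : ℕ =>
    exists_gradTest_norm_sub_lt (hPmem n) (Nat.one_div_pos_of_nat (α := ℝ) (n := n))
  set G : ℕ → VecL2 Ω := fun n => testL2 Ω (gradTest (ψ n)) with hG
  have hr : Tendsto (fun n => ‖P (v n) - G n‖) atTop (𝓝 0) :=
    squeeze_zero (fun n => norm_nonneg _) (fun n => (hψ n).le)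
      tendsto_one_div_add_atTop_nhds_zero_nat
  have hGB : ∀ n, ‖G n‖ ≤ B + 1 := by
    intro n
    have h1 : (1 : ℝ) / (n + 1) ≤ 1 := by
      rw [div_le_one (by positivity)]; linarith [(Nat.cast_nonneg n : (0 : ℝ) ≤ n)]
    have h2 := norm_sub_norm_le (G n) (P (v n))
    rw [norm_sub_rev] at h2
    linarith [hψ n, hPB n]
  have hG0 : WeakTendsto G 0 := by
    have := hP0.sub (weakTendsto_of_tendsto (tendsto_zero_iff_norm_tendsto_zero.2 hr))
    simpa using this
  obtain ⟨p, s, hs, hp⟩ := exists_subseq_tendsto_testL2 hΩ.1 hGB hG0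
  refine ⟨s, hs, ?_⟩
  have hst := hs.tendsto_atTop
  -- `κ ‖G‖² ≤ ⟨E G, G⟩`, where `⟨E v, G⟩ = -⟨d, ψ⟩` and `v - G` is small
  have hle : ∀ n, κ * ‖G n‖ ^ 2 ≤ - inner ℝ (d n) (testL2 Ω (ψ n)) +
      ‖E‖ * (‖v n - P (v n)‖ + ‖P (v n) - G n‖) * (B + 1) := by
    intro n
    have h1 := le_inner_epsOp hb hcoer (G n)
    have h2 := (hasWeakDiv_iff hb).1 (hd n) (ψ n)
    have h3 : inner ℝ (E (G n)) (G n) =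
        inner ℝ (E (v n)) (G n) - inner ℝ (E (v n - G n)) (G n) := by
      rw [map_sub, inner_sub_left]; ring
    have h4 : ‖E (v n - G n)‖ ≤ ‖E‖ * (‖v n - P (v n)‖ + ‖P (v n) - G n‖) := by
      refine (E.le_opNorm _).trans (mul_le_mul_of_nonneg_left ?_ (norm_nonneg _))
      have := norm_add_le (v n - P (v n)) (P (v n) - G n)
      rwa [sub_add_sub_cancel] at this
    have h5 : -inner ℝ (E (v n - G n)) (G n) ≤
        ‖E‖ * (‖v n - P (v n)‖ + ‖P (v n) - G n‖) * (B + 1) := by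
      refine (neg_le_abs _).trans ((abs_real_inner_le_norm _ _).trans ?_)
      exact mul_le_mul h4 (hGB n) (norm_nonneg _) (by positivity)
    rw [← hE] at h1 h2
    linarith
  have hlim : Tendsto (fun n => - inner ℝ (d (s n)) (testL2 Ω (ψ (s n))) +
      ‖E‖ * (‖v (s n) - P (v (s n))‖ + ‖P (v (s n)) - G (s n)‖) * (B + 1)) atTop (𝓝 0) := by
    have h1 := ((hd0.comp hs).inner_tendsto (fun n => hdB (s n)) hp).neg
    have h2 := ((((hw.comp hst).add (hr.comp hst)).const_mul ‖E‖).mul_const (B + 1))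
    have h3 := h1.add h2
    simpa using h3
  have hGs : Tendsto (fun n => ‖G (s n)‖ ^ 2) atTop (𝓝 0) := by
    have h1 : Tendsto (fun n => κ * ‖G (s n)‖ ^ 2) atTop (𝓝 0) :=
      squeeze_zero (fun n => by positivity) (fun n => hle (s n)) hlim
    have h2 := h1.const_mul κ⁻¹
    rw [mul_zero] at h2
    refine h2.congr fun n => ?_
    field_simp
  have hGs' : Tendsto (fun n => G (s n)) atTop (𝓝 0) := by
    rw [tendsto_zero_iff_norm_tendsto_zero]
    simpa using hGs.sqrt
  have h1 := ((tendsto_zero_iff_norm_tendsto_zero.2 hw).comp hst).add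
    (((tendsto_zero_iff_norm_tendsto_zero.2 hr).comp hst).add hGs')
  simpa using h1

/-- Bounded sequences in `X_N^ε(Ω)` have subsequences which converge strongly in `L²`, to a limit in
`X_N^ε(Ω)`, with weak convergence of the curls and of the divergences. -/
theorem exists_subseq_XN {Ω : Opens E3} {α β γ : ℝ} (hα : 0 < α)
    (hαβ : α < β) (hγ : 0 < γ) (hΩ : IsGaffneyDomain Ω α β γ)
    {ε : E3 → Matrix (Fin 3) (Fin 3) ℝ} (hε : Admissible Ω ε) {u : ℕ → VecL2 Ω}
    (hu : ∀ n, u n ∈ XN Ω ε) {B : ℝ} (huB : ∀ n, ‖u n‖ ≤ B) (hcB : ∀ n, ‖curl Ω (u n)‖ ≤ B)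
    (hdB : ∀ n, ‖divEps Ω ε (u n)‖ ≤ B) :
    ∃ a ∈ XN Ω ε, ∃ s : ℕ → ℕ, StrictMono s ∧ Tendsto (fun n => u (s n)) atTop (𝓝 a) ∧
      WeakTendsto (fun n => curl Ω (u (s n))) (curl Ω a) ∧
      WeakTendsto (fun n => divEps Ω ε (u (s n))) (divEps Ω ε a) := by
  have hb := hε.1.memLp
  have hdiv : ∀ n, HasWeakDiv Ω ε (u n) (divEps Ω ε (u n)) := by
    intro n
    obtain ⟨d, hd⟩ := (hu n).2
    rwa [divEps_eq hb hd]
  let q : ℕ → WithLp 2 (VecL2 Ω × VecL2 Ω) := fun n => WithLp.toLp 2 (u n, curl Ω (u n))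
  have hq : ∀ n, q n ∈ curlGraph Ω := fun n => mem_curlGraph_of_mem_HCurlZero (hu n).1
  have hqB : ∀ n, ‖q n‖ ≤ B + B := by
    intro n
    rw [WithLp.prod_norm_eq_of_L2]
    refine Real.sqrt_le_iff.2 ⟨by linarith [(norm_nonneg _).trans (huB 0)], ?_⟩
    change ‖u n‖ ^ 2 + ‖curl Ω (u n)‖ ^ 2 ≤ _
    nlinarith [huB n, hcB n, norm_nonneg (u n), norm_nonneg (curl Ω (u n))]
  obtain ⟨a, s₁, hs₁, ha⟩ := exists_subseq_weakTendsto hqB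
  obtain ⟨d, s₂, hs₂, hd⟩ := exists_subseq_weakTendsto (x := fun n => divEps Ω ε (u (s₁ n)))
    fun n => hdB (s₁ n)
  have ha' := ha.comp hs₂
  have hamem : a ∈ curlGraph Ω := ha'.mem (Submodule.isClosed_topologicalClosure _) fun n => hq _
  have hu1 : WeakTendsto (fun n => u (s₁ (s₂ n))) a.fst := by
    intro y
    have := ha' (WithLp.toLp 2 (y, 0))
    simpa [WithLp.prod_inner_apply, q] using this
  have hu2 : WeakTendsto (fun n => curl Ω (u (s₁ (s₂ n)))) a.snd := by
    intro y
    have := ha' (WithLp.toLp 2 (0, y))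
    simpa [WithLp.prod_inner_apply, q] using this
  have hcurl : HasWeakCurl Ω a.fst a.snd := hasWeakCurl_of_mem_curlGraph hamem
  have hdiva : HasWeakDiv Ω ε a.fst d := by
    rw [hasWeakDiv_iff hb]
    intro φ
    refine tendsto_nhds_unique ((hu1.map (epsOp hb)) _) ?_
    refine (hd (testL2 Ω φ)).neg.congr fun n => ?_
    exact ((hasWeakDiv_iff hb).1 (hdiv (s₁ (s₂ n))) φ).symm
  have haXN : a.fst ∈ XN Ω ε := ⟨mem_HCurlZero_of_mem_curlGraph hamem, ⟨d, hdiva⟩⟩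
  have hv1 := hu1.sub_const a.fst
  have hd1 := hd.sub_const d
  rw [sub_self] at hv1 hd1
  obtain ⟨s₃, hs₃, hlim⟩ := exists_subseq_tendsto_zero hα hαβ hγ hΩ hε
    (v := fun n => u (s₁ (s₂ n)) - a.fst) (c := fun n => curl Ω (u (s₁ (s₂ n))) - a.snd)
    (d := fun n => divEps Ω ε (u (s₁ (s₂ n))) - d)
    (B := B + (‖a.fst‖ + ‖a.snd‖ + ‖d‖))
    (fun n => (curlGraph Ω).sub_mem (hq (s₁ (s₂ n))) hamem)
    (fun n => by
      rw [hasWeakDiv_iff hb]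
      intro φ
      have h1 := (hasWeakDiv_iff hb).1 (hdiv (s₁ (s₂ n))) φ
      have h2 := (hasWeakDiv_iff hb).1 hdiva φ
      rw [map_sub, inner_sub_left, inner_sub_left]
      linarith)
    (fun n => (norm_sub_le _ _).trans (by
      linarith [huB (s₁ (s₂ n)), norm_nonneg a.snd, norm_nonneg d]))
    (fun n => (norm_sub_le _ _).trans (by
      linarith [hcB (s₁ (s₂ n)), norm_nonneg a.fst, norm_nonneg d]))
    (fun n => (norm_sub_le _ _).trans (by
      linarith [hdB (s₁ (s₂ n)), norm_nonneg a.fst, norm_nonneg a.snd]))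
    hv1 hd1
  refine ⟨a.fst, haXN, s₁ ∘ s₂ ∘ s₃, hs₁.comp (hs₂.comp hs₃), ?_, ?_, ?_⟩
  · have := hlim.add_const a.fst
    simpa using this
  · rw [curl_eq hcurl]
    exact hu2.comp hs₃
  · rw [divEps_eq hb hdiva]
    exact hd.comp hs₃

/-! ### Compact pairs of quadratic forms -/

section Forms

variable {V : Type} [AddCommGroup V] [Module ℝ V]

/-- A pair of symmetric bilinear forms, `a` nonnegative and `b` positive definite, such that a
sequence bounded for `a + b` has a subsequence that converges for `b` and weakly for `a`. -/
structure IsCompactPair (a b : V →ₗ[ℝ] V →ₗ[ℝ] ℝ) : Prop where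
  symm_left : ∀ x y, a x y = a y x
  symm_right : ∀ x y, b x y = b y x
  nonneg : ∀ x, 0 ≤ a x x
  pos : ∀ x, x ≠ 0 → 0 < b x x
  compact : ∀ (u : ℕ → V) (B : ℝ), (∀ n, a (u n) (u n) + b (u n) (u n) ≤ B) →
    ∃ (v : V) (s : ℕ → ℕ), StrictMono s ∧
      Tendsto (fun n => b (u (s n) - v) (u (s n) - v)) atTop (𝓝 0) ∧
      ∀ w, Tendsto (fun n => a (u (s n)) w) atTop (𝓝 (a v w))

/-- `u` is an eigenvector of `a` relative to `b`, with eigenvalue `t`. -/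
def IsEigenvector (a b : V →ₗ[ℝ] V →ₗ[ℝ] ℝ) (t : ℝ) (u : V) : Prop :=
  u ≠ 0 ∧ ∀ w, a u w = t * b u w

/-- The `j`-th eigenvalue of `a` relative to `b`, counted with multiplicity. -/
def eigenvalueAt (a b : V →ₗ[ℝ] V →ₗ[ℝ] ℝ) (j : ℕ) : ℝ :=
  sInf {s : ℝ | (j : Cardinal) ≤
    Module.rank ℝ (Submodule.span ℝ {u : V | ∃ t ≤ s, IsEigenvector a b t u})}

variable {a b : V →ₗ[ℝ] V →ₗ[ℝ] ℝ}

theorem IsCompactPair.nonneg_right (h : IsCompactPair a b) (x : V) : 0 ≤ b x x := by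
  by_cases hx : x = 0
  · simp [hx]
  · exact (h.pos x hx).le

theorem sq_apply_le {q : V →ₗ[ℝ] V →ₗ[ℝ] ℝ} (hs : ∀ x y, q x y = q y x) (h0 : ∀ x, 0 ≤ q x x)
    (x y : V) : q x y ^ 2 ≤ q x x * q y y :=
  LinearMap.BilinForm.apply_sq_le_of_symm q h0 ⟨hs⟩ x y

theorem tendsto_apply_of_tendsto_sub {q : V →ₗ[ℝ] V →ₗ[ℝ] ℝ} (hs : ∀ x y, q x y = q y x)
    (h0 : ∀ x, 0 ≤ q x x) {u : ℕ → V} {v : V}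
    (h : Tendsto (fun n => q (u n - v) (u n - v)) atTop (𝓝 0)) (w : V) :
    Tendsto (fun n => q (u n) w) atTop (𝓝 (q v w)) := by
  have h1 : Tendsto (fun n => Real.sqrt (q (u n - v) (u n - v) * q w w)) atTop (𝓝 0) := by
    simpa using (h.mul_const (q w w)).sqrt
  have h2 : Tendsto (fun n => q (u n - v) w) atTop (𝓝 0) :=
    squeeze_zero_norm (fun n => Real.abs_le_sqrt (sq_apply_le hs h0 _ _)) h1
  have h3 := h2.add_const (q v w)
  simpa using h3

theorem tendsto_apply_self_of_tendsto_sub {q : V →ₗ[ℝ] V →ₗ[ℝ] ℝ} (hs : ∀ x y, q x y = q y x)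
    (h0 : ∀ x, 0 ≤ q x x) {u : ℕ → V} {v : V}
    (h : Tendsto (fun n => q (u n - v) (u n - v)) atTop (𝓝 0)) :
    Tendsto (fun n => q (u n) (u n)) atTop (𝓝 (q v v)) := by
  have h1 := (h.add ((tendsto_apply_of_tendsto_sub hs h0 h v).const_mul 2)).sub_const (q v v)
  have e : (0 : ℝ) + 2 * q v v - q v v = q v v := by ring
  rw [e] at h1
  refine h1.congr fun n => ?_
  simp only [map_sub, LinearMap.sub_apply, hs v (u n)]
  ring

/-- The Rayleigh quotient attains its minimum on a nonzero `b`-orthogonal complement. -/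
theorem IsCompactPair.exists_minimizer (h : IsCompactPair a b) {ι : Type} (e : ι → V)
    (hne : ∃ u ≠ 0, ∀ i, b u (e i) = 0) :
    ∃ v, b v v = 1 ∧ (∀ i, b v (e i) = 0) ∧
      ∀ w, (∀ i, b w (e i) = 0) → a v v * b w w ≤ a w w := by
  set R : Set ℝ := {r | ∃ u, b u u = 1 ∧ (∀ i, b u (e i) = 0) ∧ a u u = r} with hR
  have hnormalize : ∀ w, w ≠ 0 → (∀ i, b w (e i) = 0) → a w w / b w w ∈ R := by
    intro w hw hwe
    have hpos := h.pos w hw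
    have hsq : Real.sqrt (b w w) ^ 2 = b w w := Real.sq_sqrt hpos.le
    have hsq0 : Real.sqrt (b w w) ≠ 0 := (Real.sqrt_pos.2 hpos).ne'
    refine ⟨(Real.sqrt (b w w))⁻¹ • w, ?_, fun i => ?_, ?_⟩
    · simp only [map_smul, LinearMap.smul_apply, smul_eq_mul]
      rw [← mul_assoc, ← mul_inv, ← sq, hsq, inv_mul_cancel₀ hpos.ne']
    · simp [hwe i]
    · simp only [map_smul, LinearMap.smul_apply, smul_eq_mul]
      rw [← mul_assoc, ← mul_inv, ← sq, hsq]
      ring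
  have hRne : R.Nonempty := by
    obtain ⟨u, hu, hue⟩ := hne
    exact ⟨_, hnormalize u hu hue⟩
  have hRbdd : BddBelow R := ⟨0, by rintro _ ⟨u, -, -, rfl⟩; exact h.nonneg u⟩
  obtain ⟨r, -, hr, hrR⟩ := exists_seq_tendsto_sInf hRne hRbdd
  choose u hu1 hue hua using hrR
  obtain ⟨B, hB⟩ := hr.bddAbove_range
  obtain ⟨v, s, hs, hb, ha⟩ := h.compact u (B + 1) fun n => by
    rw [hu1, hua]
    linarith [hB ⟨n, rfl⟩]
  have hvv : b v v = 1 := by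
    refine tendsto_nhds_unique
      (tendsto_apply_self_of_tendsto_sub h.symm_right h.nonneg_right hb) ?_
    simp only [hu1]
    exact tendsto_const_nhds
  have hve : ∀ i, b v (e i) = 0 := by
    intro i
    refine tendsto_nhds_unique
      (tendsto_apply_of_tendsto_sub h.symm_right h.nonneg_right hb (e i)) ?_
    simp only [hue]
    exact tendsto_const_nhds
  have hle : a v v ≤ sInf R := by
    have h1 : a v v ^ 2 ≤ sInf R * a v v := by
      refine le_of_tendsto_of_tendsto' ((ha v).pow 2)
        ((hr.comp hs.tendsto_atTop).mul_const (a v v)) fun n => ?_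
      have := sq_apply_le h.symm_left h.nonneg (u (s n)) v
      rwa [hua] at this
    by_contra! hlt
    have h2 : 0 ≤ sInf R := Real.sInf_nonneg (by rintro _ ⟨u, -, -, rfl⟩; exact h.nonneg u)
    nlinarith
  refine ⟨v, hvv, hve, fun w hwe => ?_⟩
  by_cases hw : w = 0
  · simp [hw]
  · exact (le_div_iff₀ (h.pos w hw)).1 (hle.trans (csInf_le hRbdd (hnormalize w hw hwe)))

/-- The `b`-projection on the span of a `b`-orthonormal family. -/
def formProj (b : V →ₗ[ℝ] V →ₗ[ℝ] ℝ) {M : ℕ} (e : Fin M → V) (u : V) : V :=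
  ∑ i, b u (e i) • e i

theorem apply_sub_formProj {M : ℕ} {e : Fin M → V}
    (horth : ∀ i j, b (e i) (e j) = if i = j then 1 else 0) (u : V) (j : Fin M) :
    b (u - formProj b e u) (e j) = 0 := by
  simp [formProj, horth]

theorem apply_formProj_eq_zero (ha : ∀ x y, a x y = a y x) {M : ℕ} {e : Fin M → V} {w : V}
    (hw : ∀ i, a w (e i) = 0) (u : V) : a (formProj b e u) w = 0 := by
  simp only [formProj, map_sum, map_smul, LinearMap.sum_apply, LinearMap.smul_apply, ha _ w, hw,
    smul_zero, Finset.sum_const_zero]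

theorem IsEigenvector.apply_eq_zero (h : IsCompactPair a b) {s t : ℝ} {u v : V}
    (hu : IsEigenvector a b s u) (hv : IsEigenvector a b t v) (hst : s ≠ t) : b u v = 0 := by
  have h1 := hu.2 v
  have h2 := hv.2 u
  rw [h.symm_left, h.symm_right] at h2
  have h3 : (s - t) * b u v = 0 := by linarith
  exact (mul_eq_zero.1 h3).resolve_left (sub_ne_zero.2 hst)

theorem IsEigenvector.nonneg (h : IsCompactPair a b) {t : ℝ} {u : V}
    (hu : IsEigenvector a b t u) : 0 ≤ t := by
  have h1 := hu.2 u
  have h2 := h.nonneg u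
  rw [h1] at h2
  exact nonneg_of_mul_nonneg_left h2 (h.pos u hu.1)

/-- A minimizer of the Rayleigh quotient on the orthogonal complement of eigenvectors is an
eigenvector. -/
theorem IsCompactPair.isEigenvector_of_minimizer (h : IsCompactPair a b) {M : ℕ} {e : Fin M → V}
    {μ : Fin M → ℝ} (he : ∀ i, IsEigenvector a b (μ i) (e i))
    (horth : ∀ i j, b (e i) (e j) = if i = j then 1 else 0) {v : V} (hv : b v v = 1)
    (hve : ∀ i, b v (e i) = 0) (hmin : ∀ w, (∀ i, b w (e i) = 0) → a v v * b w w ≤ a w w) :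
    IsEigenvector a b (a v v) v := by
  refine ⟨fun h0 => by simp [h0] at hv, fun w => ?_⟩
  let W : Submodule ℝ V := ⨅ i, LinearMap.ker (b.flip (e i))
  have hW : ∀ x : W, ∀ i, b x (e i) = 0 := fun x i =>
    LinearMap.mem_ker.1 ((Submodule.mem_iInf _).1 x.2 i)
  have hWmem : ∀ x, (∀ i, b x (e i) = 0) → x ∈ W := fun x hx =>
    (Submodule.mem_iInf _).2 fun i => LinearMap.mem_ker.2 (hx i)
  let q : W →ₗ[ℝ] W →ₗ[ℝ] ℝ := (a - a v v • b).domRestrict₁₂ W W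
  have hq : ∀ x y : W, q x y = a x y - a v v * b x y := fun _ _ => rfl
  -- the form `a - a(v, v) b` is nonnegative on `W` and vanishes at `v`
  have key : ∀ x, (∀ i, b x (e i) = 0) → a v x = a v v * b v x := by
    intro x hx
    have h1 := sq_apply_le (q := q) (fun x y => by rw [hq, hq, h.symm_left, h.symm_right])
      (fun x => by rw [hq]; linarith [hmin x (hW x)]) ⟨v, hWmem v hve⟩ ⟨x, hWmem x hx⟩
    rw [hq, hq _ ⟨v, hWmem v hve⟩] at h1
    simp only [hv, mul_one, sub_self, zero_mul] at h1
    have h2 := pow_eq_zero_iff (two_ne_zero) |>.1 (le_antisymm h1 (sq_nonneg _))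
    linarith
  have h1 := key _ (apply_sub_formProj horth w)
  have h2 : ∀ i, a v (e i) = 0 := fun i => by
    rw [h.symm_left, (he i).2, h.symm_right, hve, mul_zero]
  have h3 := apply_formProj_eq_zero (b := b) h.symm_left h2 w
  have h4 : b (formProj b e w) v = 0 := by
    simp [formProj, h.symm_right _ v, hve]
  rw [h.symm_left] at h3
  rw [h.symm_right] at h4
  rw [map_sub, map_sub, h3, h4, sub_zero, sub_zero] at h1
  exact h1

/-- The set defining an eigenvalue is bounded below, since all eigenvalues are nonnegative. -/
theorem IsCompactPair.bddBelow (h : IsCompactPair a b) {j : ℕ} (hj : 0 < j) :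
    BddBelow {s : ℝ | (j : Cardinal) ≤
      Module.rank ℝ (Submodule.span ℝ {u : V | ∃ t ≤ s, IsEigenvector a b t u})} := by
  refine ⟨0, fun s hs => ?_⟩
  by_contra! hlt
  have hempty : {u : V | ∃ t ≤ s, IsEigenvector a b t u} = ∅ := by
    ext u
    simp only [Set.mem_ofPred_eq, Set.mem_empty_iff_false, iff_false]
    rintro ⟨t, hts, hu⟩
    linarith [hu.nonneg h]
  rw [Set.mem_ofPred_eq, hempty, Submodule.span_empty, rank_bot] at hs
  have : j = 0 := by exact_mod_cast nonpos_iff_eq_zero.1 hs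
  omega

/-- The first `j` eigenvectors and one more, orthogonal to them, span a space of dimension
`j + 1`. -/
theorem IsCompactPair.natCast_le_rank (h : IsCompactPair a b) {M : ℕ} {e : Fin M → V}
    {μ : Fin M → ℝ} (he : ∀ i, IsEigenvector a b (μ i) (e i))
    (horth : ∀ i j, b (e i) (e j) = if i = j then 1 else 0) {v : V} {l : ℝ}
    (hv : IsEigenvector a b l v) (hve : ∀ i, b v (e i) = 0) {j : ℕ} (hj : j ≤ M)
    (hle : ∀ i : Fin M, (i : ℕ) < j → μ i ≤ l) :
    ((j + 1 : ℕ) : Cardinal) ≤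
      Module.rank ℝ (Submodule.span ℝ {u : V | ∃ t ≤ l, IsEigenvector a b t u}) := by
  let f : Fin (j + 1) → V := Fin.snoc (fun i => e (Fin.castLE hj i)) v
  have hfl : f (Fin.last j) = v := Fin.snoc_last _ _
  have hfc : ∀ i : Fin j, f i.castSucc = e (Fin.castLE hj i) := fun i => Fin.snoc_castSucc _ _ _
  have hf : LinearIndependent ℝ f := by
    refine LinearMap.linearIndependent_of_isOrthoᵢ (B := b)
      (LinearMap.isOrthoᵢ_def.2 fun i k hik => ?_) fun i => ?_
    · induction i using Fin.lastCases with
      | last =>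
        induction k using Fin.lastCases with
        | last => exact absurd rfl hik
        | cast k => rw [hfl, hfc, hve]
      | cast i =>
        induction k using Fin.lastCases with
        | last => rw [hfl, hfc, h.symm_right, hve]
        | cast k =>
          rw [hfc, hfc, horth, if_neg]
          intro heq
          exact hik (congrArg _ (Fin.castLE_injective hj heq))
    · induction i using Fin.lastCases with
      | last => rw [hfl]; exact (h.pos v hv.1).ne'
      | cast i => rw [hfc, horth, if_pos rfl]; exact one_ne_zero
  have hspan : Submodule.span ℝ (Set.range f) ≤
      Submodule.span ℝ {u : V | ∃ t ≤ l, IsEigenvector a b t u} := by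
    refine Submodule.span_mono ?_
    rintro _ ⟨i, rfl⟩
    induction i using Fin.lastCases with
    | last => rw [hfl]; exact ⟨l, le_rfl, hv⟩
    | cast i => rw [hfc]; exact ⟨_, hle (Fin.castLE hj i) i.2, he _⟩
  refine le_trans (le_of_eq ?_) (Submodule.rank_mono hspan)
  rw [rank_span hf, Cardinal.mk_range_eq f hf.injective, Cardinal.mk_fin]

/-- The minimum of the Rayleigh quotient on the orthogonal complement of the first `M`
eigenvectors is the next eigenvalue. -/
theorem IsCompactPair.exists_eigenvector (h : IsCompactPair a b) {M : ℕ} {e : Fin M → V}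
    (he : ∀ i : Fin M, IsEigenvector a b (eigenvalueAt a b ((i : ℕ) + 1)) (e i))
    (horth : ∀ i j, b (e i) (e j) = if i = j then 1 else 0)
    (hinf : ∃ u, u ∉ Submodule.span ℝ (Set.range e)) :
    ∃ v, IsEigenvector a b (eigenvalueAt a b (M + 1)) v ∧ b v v = 1 ∧ (∀ i, b v (e i) = 0) ∧
      ∀ w, (∀ i, b w (e i) = 0) → eigenvalueAt a b (M + 1) * b w w ≤ a w w := by
  have hproj : ∀ u, formProj b e u ∈ Submodule.span ℝ (Set.range e) := fun u =>
    Submodule.sum_mem _ fun i _ => Submodule.smul_mem _ _ (Submodule.subset_span ⟨i, rfl⟩)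
  obtain ⟨v, hvv, hve, hmin⟩ := h.exists_minimizer e (by
    obtain ⟨u, hu⟩ := hinf
    refine ⟨u - formProj b e u, fun h0 => hu ?_, apply_sub_formProj horth u⟩
    rw [sub_eq_zero.1 h0]
    exact hproj u)
  have hv := h.isEigenvector_of_minimizer he horth hvv hve hmin
  have hmem : ∀ j ≤ M, (∀ i : Fin M, (i : ℕ) < j → eigenvalueAt a b ((i : ℕ) + 1) ≤ a v v) →
      a v v ∈ {s : ℝ | ((j + 1 : ℕ) : Cardinal) ≤
        Module.rank ℝ (Submodule.span ℝ {u : V | ∃ t ≤ s, IsEigenvector a b t u})} :=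
    fun j hj hle => h.natCast_le_rank he horth hv hve hj hle
  -- by induction, `v` is available as a further eigenvector at every stage
  have hle : ∀ j ≤ M, eigenvalueAt a b (j + 1) ≤ a v v := by
    intro j
    induction j using Nat.strong_induction_on with
    | _ j ih =>
      intro hj
      exact csInf_le (h.bddBelow j.succ_pos)
        (hmem j hj fun i hi => ih i hi i.2.le)
  have heq : eigenvalueAt a b (M + 1) = a v v := by
    refine le_antisymm (hle M le_rfl) (le_csInf ⟨_, hmem M le_rfl fun i _ => hle i i.2.le⟩ ?_)
    intro s hs
    by_contra! hlt
    -- an eigenvector with eigenvalue below `a v v` lies in the span of `e`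
    have hsub : {u : V | ∃ t ≤ s, IsEigenvector a b t u} ⊆ Submodule.span ℝ (Set.range e) := by
      rintro u ⟨t, hts, hu⟩
      by_contra hmem
      have hne : u - formProj b e u ≠ 0 := fun h0 => hmem (by rw [sub_eq_zero.1 h0]; exact hproj u)
      have hpe : ∀ w, a (formProj b e u) w = t * b (formProj b e u) w := by
        intro w
        simp only [formProj, map_sum, map_smul, LinearMap.sum_apply, LinearMap.smul_apply,
          smul_eq_mul, Finset.mul_sum]
        refine Finset.sum_congr rfl fun i _ => ?_
        by_cases ht : t = eigenvalueAt a b ((i : ℕ) + 1)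
        · rw [(he i).2, ← ht]; ring
        · rw [hu.apply_eq_zero h (he i) ht]; ring
      have h1 := hmin _ (apply_sub_formProj horth u)
      have h2 : a (u - formProj b e u) (u - formProj b e u) =
          t * b (u - formProj b e u) (u - formProj b e u) := by
        rw [map_sub a, map_sub b, LinearMap.sub_apply, LinearMap.sub_apply, hu.2, hpe]
        ring
      have h3 := h.pos _ hne
      rw [h2] at h1
      linarith [le_of_mul_le_mul_right h1 h3]
    have h1 : Module.rank ℝ (Submodule.span ℝ {u : V | ∃ t ≤ s, IsEigenvector a b t u}) ≤ M := by
      refine (Submodule.rank_mono (Submodule.span_le.2 hsub)).trans ((rank_span_le _).trans ?_)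
      exact Cardinal.mk_range_le.trans (by simp)
    have h2 : ((M + 1 : ℕ) : Cardinal) ≤ (M : ℕ) := le_trans hs h1
    have h3 : M + 1 ≤ M := by exact_mod_cast h2
    omega
  rw [heq]
  exact ⟨v, hv, hvv, hve, hmin⟩

/-- Auchmuty's inequality: the one-variable function `r ↦ (l + 1) r² / 2 - r` is at least
`-1 / (2 (l + 1))`. -/
theorem IsCompactPair.auchmuty_le (h : IsCompactPair a b) {M : ℕ} {e : Fin M → V}
    {μ : Fin M → ℝ} (he : ∀ i, IsEigenvector a b (μ i) (e i))
    (horth : ∀ i j, b (e i) (e j) = if i = j then 1 else 0) {l : ℝ} (hl : 0 ≤ l)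
    (hmin : ∀ w, (∀ i, b w (e i) = 0) → l * b w w ≤ a w w) (u : V) :
    -(1 / 2) * (l + 1)⁻¹ ≤ 1 / 2 * (b u u + a u u) -
      Real.sqrt (b (u - formProj b e u) (u - formProj b e u)) := by
  set p := formProj b e u with hp
  set w := u - p with hw
  have hwe : ∀ i, b w (e i) = 0 := apply_sub_formProj horth u
  have hae : ∀ i, a w (e i) = 0 := fun i => by
    rw [h.symm_left, (he i).2, h.symm_right, hwe, mul_zero]
  have h1 : a p w = 0 := apply_formProj_eq_zero h.symm_left hae u
  have h2 : b p w = 0 := by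
    simp [hp, formProj, h.symm_right _ w, hwe]
  have hu : u = p + w := by rw [hw]; abel
  have h3 : a u u = a p p + a w w := by
    rw [hu]
    simp only [map_add, LinearMap.add_apply, h1, h.symm_left w p]
    ring
  have h4 : b u u = b p p + b w w := by
    rw [hu]
    simp only [map_add, LinearMap.add_apply, h2, h.symm_right w p]
    ring
  have h5 := hmin w hwe
  have h6 : Real.sqrt (b w w) ^ 2 = b w w := Real.sq_sqrt (h.nonneg_right w)
  have h7 := h.nonneg p
  have h8 := h.nonneg_right p
  set r := Real.sqrt (b w w)
  have h9 : -(1 / 2) * (l + 1)⁻¹ ≤ 1 / 2 * ((l + 1) * r ^ 2) - r := by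
    have e1 : 1 / 2 * ((l + 1) * r ^ 2) - r + 1 / 2 * (l + 1)⁻¹ =
        1 / 2 * (l + 1) * (r - (l + 1)⁻¹) ^ 2 := by
      field_simp
      ring
    have e2 : 0 ≤ 1 / 2 * (l + 1) * (r - (l + 1)⁻¹) ^ 2 := by positivity
    linarith
  rw [h3, h4]
  nlinarith

theorem IsEigenvector.auchmuty_eq {M : ℕ} {e : Fin M → V} {l : ℝ} (hl : 0 ≤ l) {v : V}
    (hv : IsEigenvector a b l v) (hve : ∀ i, b v (e i) = 0) (hb : 0 ≤ b v v)
    (hnorm : Real.sqrt (b v v) = (l + 1)⁻¹) :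
    1 / 2 * (b v v + a v v) - Real.sqrt (b (v - formProj b e v) (v - formProj b e v)) =
      -(1 / 2) * (l + 1)⁻¹ := by
  have hp : formProj b e v = 0 := by simp [formProj, hve]
  have h1 : b v v = (l + 1)⁻¹ ^ 2 := by rw [← hnorm, Real.sq_sqrt hb]
  rw [hp, sub_zero, hnorm, hv.2, h1]
  field_simp
  ring

end Forms

/-! ### The forms of the penalized problem -/

section Problem

variable {Ω : Opens E3} {ε : E3 → Matrix (Fin 3) (Fin 3) ℝ}

theorem mem_curlGraph_of_mem_XN {u : VecL2 Ω} (hu : u ∈ XN Ω ε) :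
    WithLp.toLp 2 (u, curl Ω u) ∈ curlGraph Ω :=
  mem_curlGraph_of_mem_HCurlZero hu.1

theorem hasWeakDiv_of_mem_XN (hb : ∀ i j, MemLp (fun x => ε x i j) ∞ (vol Ω)) {u : VecL2 Ω}
    (hu : u ∈ XN Ω ε) : HasWeakDiv Ω ε u (divEps Ω ε u) := by
  obtain ⟨d, hd⟩ := hu.2
  rwa [divEps_eq hb hd]

theorem hasWeakDiv_add (hb : ∀ i j, MemLp (fun x => ε x i j) ∞ (vol Ω)) {u v : VecL2 Ω}
    {d d' : ScalL2 Ω} (hu : HasWeakDiv Ω ε u d) (hv : HasWeakDiv Ω ε v d') :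
    HasWeakDiv Ω ε (u + v) (d + d') := by
  rw [hasWeakDiv_iff hb] at *
  intro φ
  rw [map_add, inner_add_left, inner_add_left, hu, hv]
  ring

theorem hasWeakDiv_smul (hb : ∀ i j, MemLp (fun x => ε x i j) ∞ (vol Ω)) {u : VecL2 Ω}
    {d : ScalL2 Ω} (c : ℝ) (hu : HasWeakDiv Ω ε u d) : HasWeakDiv Ω ε (c • u) (c • d) := by
  rw [hasWeakDiv_iff hb] at *
  intro φ
  rw [map_smul, inner_smul_left, inner_smul_left, hu]
  simp

theorem add_mem_curlGraph {u v w w' : VecL2 Ω} (hu : WithLp.toLp 2 (u, w) ∈ curlGraph Ω)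
    (hv : WithLp.toLp 2 (v, w') ∈ curlGraph Ω) :
    WithLp.toLp 2 (u + v, w + w') ∈ curlGraph Ω :=
  (curlGraph Ω).add_mem hu hv

theorem smul_mem_curlGraph {u w : VecL2 Ω} (c : ℝ) (hu : WithLp.toLp 2 (u, w) ∈ curlGraph Ω) :
    WithLp.toLp 2 (c • u, c • w) ∈ curlGraph Ω :=
  (curlGraph Ω).smul_mem c hu

/-- `X_N^ε(Ω)` as a linear subspace of `L²(Ω)³`. -/
def XNSubmodule (hb : ∀ i j, MemLp (fun x => ε x i j) ∞ (vol Ω)) : Submodule ℝ (VecL2 Ω) where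
  carrier := XN Ω ε
  add_mem' hu hv :=
    ⟨mem_HCurlZero_of_mem_curlGraph
      (add_mem_curlGraph (mem_curlGraph_of_mem_XN hu) (mem_curlGraph_of_mem_XN hv)),
      ⟨_, hasWeakDiv_add hb (hasWeakDiv_of_mem_XN hb hu) (hasWeakDiv_of_mem_XN hb hv)⟩⟩
  zero_mem' :=
    ⟨mem_HCurlZero_of_mem_curlGraph (w := 0) (curlGraph Ω).zero_mem,
      ⟨0, (hasWeakDiv_iff hb).2 fun φ => by simp⟩⟩
  smul_mem' c _ hu :=
    ⟨mem_HCurlZero_of_mem_curlGraph (smul_mem_curlGraph c (mem_curlGraph_of_mem_XN hu)),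
      ⟨_, hasWeakDiv_smul hb c (hasWeakDiv_of_mem_XN hb hu)⟩⟩

/-- The curl as a linear map on `X_N^ε(Ω)`. -/
def curlLin (hb : ∀ i j, MemLp (fun x => ε x i j) ∞ (vol Ω)) : XNSubmodule hb →ₗ[ℝ] VecL2 Ω where
  toFun u := curl Ω u
  map_add' u v := curl_eq (hasWeakCurl_of_mem_curlGraph
    (add_mem_curlGraph (mem_curlGraph_of_mem_XN u.2) (mem_curlGraph_of_mem_XN v.2)))
  map_smul' c u := curl_eq (hasWeakCurl_of_mem_curlGraph
    (smul_mem_curlGraph c (mem_curlGraph_of_mem_XN u.2)))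

/-- The divergence `u ↦ div (ε u)` as a linear map on `X_N^ε(Ω)`. -/
def divLin (hb : ∀ i j, MemLp (fun x => ε x i j) ∞ (vol Ω)) : XNSubmodule hb →ₗ[ℝ] ScalL2 Ω where
  toFun u := divEps Ω ε u
  map_add' u v := divEps_eq hb
    (hasWeakDiv_add hb (hasWeakDiv_of_mem_XN hb u.2) (hasWeakDiv_of_mem_XN hb v.2))
  map_smul' c u := divEps_eq hb (hasWeakDiv_smul hb c (hasWeakDiv_of_mem_XN hb u.2))

/-- The inner product `⟨u, v⟩_ε` on `X_N^ε(Ω)`, as a bilinear form. -/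
def massForm (hb : ∀ i j, MemLp (fun x => ε x i j) ∞ (vol Ω)) :
    XNSubmodule hb →ₗ[ℝ] XNSubmodule hb →ₗ[ℝ] ℝ :=
  (innerₗ (VecL2 Ω)).compl₁₂ ((epsOp hb).toLinearMap ∘ₗ (XNSubmodule hb).subtype)
    (XNSubmodule hb).subtype

/-- The form `∫ curl u · curl v + τ ∫ div (ε u) div (ε v)` on `X_N^ε(Ω)`. -/
def stiffnessForm (hb : ∀ i j, MemLp (fun x => ε x i j) ∞ (vol Ω)) (τ : ℝ) :
    XNSubmodule hb →ₗ[ℝ] XNSubmodule hb →ₗ[ℝ] ℝ :=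
  (innerₗ (VecL2 Ω)).compl₁₂ (curlLin hb) (curlLin hb) +
    τ • (innerₗ (ScalL2 Ω)).compl₁₂ (divLin hb) (divLin hb)

variable (hb : ∀ i j, MemLp (fun x => ε x i j) ∞ (vol Ω))

theorem massForm_apply (u v : XNSubmodule hb) :
    massForm hb u v = innerEps Ω ε (u : VecL2 Ω) v := by
  rw [innerEps_eq hb]; rfl

theorem stiffnessForm_apply_eq_inner (τ : ℝ) (u v : XNSubmodule hb) :
    stiffnessForm hb τ u v = inner ℝ (curl Ω (u : VecL2 Ω)) (curl Ω (v : VecL2 Ω)) +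
      τ * inner ℝ (divEps Ω ε (u : VecL2 Ω)) (divEps Ω ε (v : VecL2 Ω)) := rfl

theorem stiffnessForm_apply (τ : ℝ) (u v : XNSubmodule hb) :
    stiffnessForm hb τ u v =
      (∫ x in (Ω : Set E3), inner ℝ (curl Ω (u : VecL2 Ω) x) (curl Ω (v : VecL2 Ω) x)) +
      τ * ∫ x in (Ω : Set E3), divEps Ω ε (u : VecL2 Ω) x * divEps Ω ε (v : VecL2 Ω) x := by
  rw [stiffnessForm_apply_eq_inner, L2.inner_def, L2.inner_def]
  congr 2
  refine integral_congr_ae (Eventually.of_forall fun x => ?_)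
  simp [mul_comm]

theorem Tform_eq (τ : ℝ) (u v : XNSubmodule hb) :
    Tform Ω ε τ (u : VecL2 Ω) v = massForm hb u v + stiffnessForm hb τ u v := by
  rw [Tform, massForm_apply, stiffnessForm_apply, add_assoc]

/-- The compactness of the embedding of `X_N^ε(Ω)`, in terms of the two forms. -/
theorem isCompactPair {α β γ : ℝ} (hα : 0 < α) (hαβ : α < β) (hγ : 0 < γ)
    (hΩ : IsGaffneyDomain Ω α β γ) (hε : Admissible Ω ε) {τ : ℝ} (hτ : 0 < τ) :
    IsCompactPair (stiffnessForm hb τ) (massForm hb) := by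
  obtain ⟨c, hc, hcoer⟩ := hε.2
  have hmass : ∀ u : XNSubmodule hb, c * ‖(u : VecL2 Ω)‖ ^ 2 ≤ massForm hb u u := fun u =>
    le_inner_epsOp hb hcoer (u : VecL2 Ω)
  have hstiff : ∀ u : XNSubmodule hb, stiffnessForm hb τ u u =
      ‖curl Ω (u : VecL2 Ω)‖ ^ 2 + τ * ‖divEps Ω ε (u : VecL2 Ω)‖ ^ 2 := fun u => by
    rw [stiffnessForm_apply_eq_inner, real_inner_self_eq_norm_sq, real_inner_self_eq_norm_sq]
  refine ⟨fun u v => ?_, fun u v => inner_epsOp_comm hb hε.1.symm _ _, fun u => ?_,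
    fun u hu => ?_, fun u B hB => ?_⟩
  · simp only [stiffnessForm_apply_eq_inner, real_inner_comm]
  · rw [hstiff]
    positivity
  · refine lt_of_lt_of_le ?_ (hmass u)
    have : 0 < ‖(u : VecL2 Ω)‖ := norm_pos_iff.2 fun h => hu (Subtype.ext h)
    positivity
  · have hm : ∀ n, 0 ≤ c * ‖(u n : VecL2 Ω)‖ ^ 2 := fun n => by positivity
    have hd : ∀ n, 0 ≤ τ * ‖divEps Ω ε (u n : VecL2 Ω)‖ ^ 2 := fun n => by positivity
    have hB' : ∀ n, c * ‖(u n : VecL2 Ω)‖ ^ 2 + (‖curl Ω (u n : VecL2 Ω)‖ ^ 2 +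
        τ * ‖divEps Ω ε (u n : VecL2 Ω)‖ ^ 2) ≤ B := fun n => by
      have := hB n
      rw [hstiff] at this
      linarith [hmass (u n)]
    set B' := Real.sqrt (B / c) + Real.sqrt B + Real.sqrt (B / τ) with hBdef
    have hs1 := Real.sqrt_nonneg (B / c)
    have hs2 := Real.sqrt_nonneg B
    have hs3 := Real.sqrt_nonneg (B / τ)
    have h1 : ∀ n, ‖(u n : VecL2 Ω)‖ ≤ B' := fun n => by
      have : ‖(u n : VecL2 Ω)‖ ≤ Real.sqrt (B / c) := by
        refine Real.le_sqrt_of_sq_le ((le_div_iff₀ hc).2 ?_)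
        linarith [hB' n, hd n, sq_nonneg ‖curl Ω (u n : VecL2 Ω)‖]
      linarith
    have h2 : ∀ n, ‖curl Ω (u n : VecL2 Ω)‖ ≤ B' := fun n => by
      have : ‖curl Ω (u n : VecL2 Ω)‖ ≤ Real.sqrt B := by
        refine Real.le_sqrt_of_sq_le ?_
        linarith [hB' n, hd n, hm n]
      linarith
    have h3 : ∀ n, ‖divEps Ω ε (u n : VecL2 Ω)‖ ≤ B' := fun n => by
      have : ‖divEps Ω ε (u n : VecL2 Ω)‖ ≤ Real.sqrt (B / τ) := by
        refine Real.le_sqrt_of_sq_le ((le_div_iff₀ hτ).2 ?_)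
        linarith [hB' n, hm n, sq_nonneg ‖curl Ω (u n : VecL2 Ω)‖]
      linarith
    obtain ⟨v, hv, s, hs, hlim, hcurl, hdiv⟩ :=
      exists_subseq_XN hα hαβ hγ hΩ hε (fun n => (u n).2) h1 h2 h3
    refine ⟨⟨v, hv⟩, s, hs, ?_, fun w => ?_⟩
    · have hsub : Tendsto (fun n => (u (s n) : VecL2 Ω) - v) atTop (𝓝 0) := by
        simpa using hlim.sub_const v
      have := (((epsOp hb).continuous.tendsto _).comp hsub).inner (𝕜 := ℝ) hsub
      rw [map_zero, inner_zero_left] at this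
      exact this
    · exact (hcurl _).add ((hdiv _).const_mul τ)

theorem isEigenfunction_iff {τ t : ℝ} {u : VecL2 Ω} :
    IsEigenfunction Ω ε τ t u ↔
      ∃ hu : u ∈ XNSubmodule hb, IsEigenvector (stiffnessForm hb τ) (massForm hb) t ⟨u, hu⟩ := by
  constructor
  · rintro ⟨hu, h0, h⟩
    refine ⟨hu, fun h' => h0 (congrArg Subtype.val h'), fun w => ?_⟩
    rw [stiffnessForm_apply, massForm_apply]
    exact h w w.2
  · rintro ⟨hu, h0, h⟩
    refine ⟨hu, fun h' => h0 (Subtype.ext h'), fun v hv => ?_⟩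
    have := h ⟨v, hv⟩
    rwa [stiffnessForm_apply, massForm_apply] at this

theorem sigma_eq (τ : ℝ) (j : ℕ) :
    sigma Ω ε τ j = eigenvalueAt (stiffnessForm hb τ) (massForm hb) j := by
  have himage : ∀ s : ℝ, {u : VecL2 Ω | ∃ t ≤ s, IsEigenfunction Ω ε τ t u} =
      (XNSubmodule hb).subtype ''
        {u | ∃ t ≤ s, IsEigenvector (stiffnessForm hb τ) (massForm hb) t u} := by
    intro s
    ext u
    constructor
    · rintro ⟨t, hts, hu⟩
      obtain ⟨hu, h⟩ := (isEigenfunction_iff hb).1 hu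
      exact ⟨⟨u, hu⟩, ⟨t, hts, h⟩, rfl⟩
    · rintro ⟨u, ⟨t, hts, h⟩, rfl⟩
      exact ⟨t, hts, (isEigenfunction_iff hb).2 ⟨u.2, h⟩⟩
  rw [sigma, eigenvalueAt]
  congr 1
  ext s
  rw [Set.mem_ofPred_eq, Set.mem_ofPred_eq, himage, Submodule.span_image,
    ← (Submodule.equivMapOfInjective _ (XNSubmodule hb).subtype_injective _).rank_eq]

theorem auchmuty_eq (τ : ℝ) {M : ℕ} (e : Fin M → XNSubmodule hb) (u : XNSubmodule hb) :
    auchmuty Ω ε τ (fun i => (e i : VecL2 Ω)) u =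
      1 / 2 * (massForm hb u u + stiffnessForm hb τ u u) -
        Real.sqrt (massForm hb (u - formProj (massForm hb) e u)
          (u - formProj (massForm hb) e u)) := by
  rw [auchmuty, Tform_eq, normEps, massForm_apply hb (u - _)]
  have : ((u - formProj (massForm hb) e u : XNSubmodule hb) : VecL2 Ω) =
      (u : VecL2 Ω) - proj Ω ε (fun i => (e i : VecL2 Ω)) u := by
    rw [formProj, proj, AddSubgroupClass.coe_sub, AddSubmonoidClass.coe_finsetSum]
    simp only [massForm_apply, SetLike.val_smul]
  rw [this]

end Problem

end Cavity

end

/-! ### The Auchmuty principle -/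

theorem mainTheorem4
    (α β γ : ℝ) (hα : 0 < α) (hαβ : α < β) (hγ : 0 < γ)
    (Ω : TopologicalSpace.Opens Cavity.E3) (hΩ : Cavity.IsGaffneyDomain Ω α β γ)
    (ε : Cavity.E3 → Matrix (Fin 3) (Fin 3) ℝ) (hε : Cavity.Admissible Ω ε)
    (τ : ℝ) (hτ : 0 < τ) (M : ℕ) (e : Fin M → Cavity.VecL2 Ω)
    (he : ∀ i : Fin M,
      Cavity.IsEigenfunction Ω ε τ (Cavity.sigma Ω ε τ ((i : ℕ) + 1)) (e i))
    (horth : ∀ i j : Fin M, Cavity.innerEps Ω ε (e i) (e j) = if i = j then 1 else 0) :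
    IsLeast (Cavity.auchmuty Ω ε τ e '' Cavity.XN Ω ε)
      (-(1 / 2) * (Cavity.sigma Ω ε τ (M + 1) + 1)⁻¹) ∧
    (∃ v : Cavity.VecL2 Ω,
      Cavity.IsEigenfunction Ω ε τ (Cavity.sigma Ω ε τ (M + 1)) v ∧
      (∀ i : Fin M, Cavity.innerEps Ω ε v (e i) = 0) ∧
      Cavity.normEps Ω ε v = (Cavity.sigma Ω ε τ (M + 1) + 1)⁻¹) ∧
    (∀ v : Cavity.VecL2 Ω,
      Cavity.IsEigenfunction Ω ε τ (Cavity.sigma Ω ε τ (M + 1)) v →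
      (∀ i : Fin M, Cavity.innerEps Ω ε v (e i) = 0) →
      Cavity.normEps Ω ε v = (Cavity.sigma Ω ε τ (M + 1) + 1)⁻¹ →
      v ∈ Cavity.XN Ω ε ∧ -v ∈ Cavity.XN Ω ε ∧
      Cavity.auchmuty Ω ε τ e v = -(1 / 2) * (Cavity.sigma Ω ε τ (M + 1) + 1)⁻¹ ∧
      Cavity.auchmuty Ω ε τ e (-v) = -(1 / 2) * (Cavity.sigma Ω ε τ (M + 1) + 1)⁻¹) := by
  have hb := hε.1.memLp
  have hpair := Cavity.isCompactPair hb hα hαβ hγ hΩ hε hτ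
  choose he' hev using fun i => (Cavity.isEigenfunction_iff hb).1 (he i)
  let f : Fin M → Cavity.XNSubmodule hb := fun i => ⟨e i, he' i⟩
  have hfe : (fun i => (f i : Cavity.VecL2 Ω)) = e := rfl
  have hforth : ∀ i j, Cavity.massForm hb (f i) (f j) = if i = j then 1 else 0 := fun i j => by
    rw [Cavity.massForm_apply, ← horth i j]
  simp only [Cavity.sigma_eq hb] at hev ⊢
  obtain ⟨v, hv, hvv, hve, hmin⟩ := hpair.exists_eigenvector (e := f) hev hforth (by
    have hfin : FiniteDimensional ℝ (Submodule.span ℝ (Set.range e)) :=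
      FiniteDimensional.span_of_finite ℝ (Set.finite_range e)
    obtain ⟨φ, hφ⟩ := Cavity.exists_testL2_notMem hΩ.1.isConnected.nonempty
      (Submodule.span ℝ (Set.range e))
    refine ⟨⟨Cavity.testL2 Ω φ, Cavity.testL2_mem_XN hε.1 φ⟩, fun hmem => hφ ?_⟩
    have h1 := Submodule.mem_map_of_mem (f := (Cavity.XNSubmodule hb).subtype) hmem
    rw [← Submodule.span_image, ← Set.range_comp] at h1
    exact h1)
  set l := Cavity.eigenvalueAt (Cavity.stiffnessForm hb τ) (Cavity.massForm hb) (M + 1) with hl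
  have hl0 : 0 ≤ l := hv.nonneg hpair
  have hattain : ∀ w : Cavity.VecL2 Ω, Cavity.IsEigenfunction Ω ε τ l w →
      (∀ i : Fin M, Cavity.innerEps Ω ε w (e i) = 0) → Cavity.normEps Ω ε w = (l + 1)⁻¹ →
      w ∈ Cavity.XN Ω ε ∧ Cavity.auchmuty Ω ε τ e w = -(1 / 2) * (l + 1)⁻¹ := by
    intro w hw hwe hwn
    obtain ⟨hwX, hwv⟩ := (Cavity.isEigenfunction_iff hb).1 hw
    refine ⟨hwX, ?_⟩
    have h1 := Cavity.auchmuty_eq hb τ f ⟨w, hwX⟩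
    rw [hfe] at h1
    refine h1.trans (hwv.auchmuty_eq hl0 (fun i => ?_) (hpair.nonneg_right _) ?_)
    · rw [Cavity.massForm_apply]; exact hwe i
    · rw [Cavity.massForm_apply]; exact hwn
  have hsmul : ∀ (r : ℝ) (w : Cavity.XNSubmodule hb),
      Cavity.IsEigenvector (Cavity.stiffnessForm hb τ) (Cavity.massForm hb) l w → r ≠ 0 →
      Cavity.IsEigenvector (Cavity.stiffnessForm hb τ) (Cavity.massForm hb) l (r • w) := by
    intro r w hw hr
    refine ⟨smul_ne_zero hr hw.1, fun x => ?_⟩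
    simp only [map_smul, LinearMap.smul_apply, smul_eq_mul, hw.2 x]
    ring
  have hr0 : 0 < (l + 1)⁻¹ := by positivity
  have hex : ∃ w : Cavity.VecL2 Ω, Cavity.IsEigenfunction Ω ε τ l w ∧
      (∀ i : Fin M, Cavity.innerEps Ω ε w (e i) = 0) ∧
      Cavity.normEps Ω ε w = (l + 1)⁻¹ := by
    refine ⟨((l + 1)⁻¹ • v : Cavity.XNSubmodule hb),
      (Cavity.isEigenfunction_iff hb).2 ⟨Subtype.prop _, hsmul _ v hv hr0.ne'⟩, fun i => ?_, ?_⟩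
    · refine (Cavity.massForm_apply hb _ (f i)).symm.trans ?_
      rw [map_smul, LinearMap.smul_apply, hve, smul_zero]
    · rw [Cavity.normEps, ← Cavity.massForm_apply hb]
      simp only [map_smul, LinearMap.smul_apply, smul_eq_mul, hvv, mul_one]
      exact Real.sqrt_mul_self hr0.le
  refine ⟨⟨?_, ?_⟩, hex, fun w hw hwe hwn => ?_⟩
  · obtain ⟨w, hw, hwe, hwn⟩ := hex
    obtain ⟨hwX, hval⟩ := hattain w hw hwe hwn
    exact ⟨w, hwX, hval⟩
  · rintro _ ⟨u, hu, rfl⟩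
    have h1 := Cavity.auchmuty_eq hb τ f ⟨u, hu⟩
    rw [hfe] at h1
    rw [h1]
    exact hpair.auchmuty_le hev hforth hl0 hmin _
  · obtain ⟨hwX, hval⟩ := hattain w hw hwe hwn
    obtain ⟨hw', hwv⟩ := (Cavity.isEigenfunction_iff hb).1 hw
    have hnw : ((-1 : ℝ) • (⟨w, hw'⟩ : Cavity.XNSubmodule hb) : Cavity.VecL2 Ω) = -w := by simp
    have hneig : Cavity.IsEigenfunction Ω ε τ l (-w) := by
      rw [← hnw]
      exact (Cavity.isEigenfunction_iff hb).2 ⟨((-1 : ℝ) • (⟨w, hw'⟩ : Cavity.XNSubmodule hb)).2,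
        hsmul _ _ hwv (by norm_num)⟩
    obtain ⟨hnX, hnval⟩ := hattain (-w) hneig
      (fun i => by rw [Cavity.innerEps_eq hb, map_neg, inner_neg_left, ← Cavity.innerEps_eq hb,
        hwe i, neg_zero])
      (by rw [← hwn, Cavity.normEps, Cavity.normEps, Cavity.innerEps_eq hb, map_neg, inner_neg_neg,
        ← Cavity.innerEps_eq hb])
    exact ⟨hwX, hnX, hval, hnval⟩
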